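/- Let $d\ge 1$ and let $\Xi$ be a nonnegative integer-valued random variable. Consider the following frog model on $\mathbb Z^d$. Let $(\Xi^x)_{x\in\mathbb Z^d}$ be i.i.d. copies of $\Xi$, let $(S^x_n)_{n\ge 0}$, $x\in\mathbb Z^d$, be independent simple random walks on $\mathbb Z^d$ with $S^x_0=x$, and let the family $(\Xi^x)_x$ be independent of the family $(S^x)_x$. Initially there is one particle at each site; the particle at the origin is active at time $0$ and all other particles are asleep. A particle from $x$ that is activated at time $T$ is present at the site $S^x_n$ at time $T+n$ for $0\le n<\Xi^x$ and then disappears; a sleeping particle is activated as soon as an active particle is present at its site. That is, the particle from $x$ is activated at the time $$T(x)=\inf\Big\{\sum_{i=1}^{m} t(x_{i-1},x_i) : m\ge 0,\ x_0=0,\ x_m=x\Big\},\qquad t(y,z)=\min\{n<\Xi^y : S^y_n=z\}\quad(\min\emptyset=\infty),$$ and never if $T(x)=\infty$. The model is called recurrent if, with positive probability, there are infinitely many times at which an active particle is at the origin. Theorem. There is a sequence of positive numbers $\beta_1,\beta_2,\beta_3,\dots$ such that the following holds for every $d\ge 1$ and every $\Xi$. If for all large enough $n$ one of the following alternatives holds: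 - $d=1$ and $\mathbf P[\Xi\ge n^2]\ge \beta_1\, n^{-1}\log\log n$, - $d=2$ and $\mathbf P[\Xi\ge n^2]\ge \beta_2\, n^{-2}(\log n)^2$, - $d\ge 3$ and $\mathbf P[\Xi\ge n^2]\ge \beta_d\, n^{-2}\log n$, then the frog model on $\mathbb Z^d$ with lifetimes distributed as $\Xi$ is recurrent. -/

import Mathlib

open MeasureTheory ProbabilityTheory Filter

namespace FrogModel

/-- The sites of the lattice `ℤ^d`. -/
abbrev Site (d : ℕ) : Type := Fin d → ℤ

/-- `W` is (on the probability space `(Ω, P)`) a discrete-time simple random walk on the graph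
`ℤ^d` started from `x`: the increments are independent, and each of them takes each of the `2d`
values `v` with `∑ i, |v i| = 1` with probability `1 / (2d)`. -/
structure IsSimpleRandomWalk {d : ℕ} {Ω : Type*} [MeasurableSpace Ω] (P : Measure Ω)
    (x : Site d) (W : ℕ → Ω → Site d) : Prop where
  measurable : ∀ n, Measurable (W n)
  start : ∀ᵐ ω ∂P, W 0 ω = x
  indep_steps : iIndepFun (fun (n : ℕ) (ω : Ω) => W (n + 1) ω - W n ω) P
  step_law : ∀ (n : ℕ) (v : Site d), ∑ i, |v i| = 1 →
    P {ω | W (n + 1) ω - W n ω = v} = (2 * (d : ENNReal))⁻¹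

/-- The random input of the frog model on `ℤ^d` with one particle per site and lifetimes having
law `ν`: `Ξ x` is the lifetime of the particle from `x` and `S x` is its trajectory.
The lifetimes are i.i.d. with law `ν`, the trajectories are independent simple random walks,
`S x` starting from `x`, and the lifetimes are independent of the trajectories. -/
structure IsInput {d : ℕ} {Ω : Type*} [MeasurableSpace Ω] (P : Measure Ω) (ν : Measure ℕ)
    (Ξ : Site d → Ω → ℕ) (S : Site d → ℕ → Ω → Site d) : Prop where
  lifetime_measurable : ∀ x, Measurable (Ξ x)
  lifetime_law : ∀ x, P.map (Ξ x) = ν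
  lifetime_indep : iIndepFun Ξ P
  walk : ∀ x, IsSimpleRandomWalk P x (S x)
  walk_indep : iIndepFun (fun (x : Site d) (ω : Ω) (n : ℕ) => S x n ω) P
  lifetime_indep_walk :
    IndepFun (fun (ω : Ω) (x : Site d) => Ξ x ω) (fun (ω : Ω) (x : Site d) (n : ℕ) => S x n ω) P

/-! For one realization: `L x` is the lifetime and `w x` the trajectory of the particle from `x`.
A particle that is activated at time `T` is present at the site `w x n` at time `T + n` for
each `n < L x`, and at no other time. -/

/-- The number of time units that the particle from `x`, once activated, needs to reach `y`
within its lifetime (`⊤` if it does not reach `y`). -/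
noncomputable def passageTime {d : ℕ} (L : Site d → ℕ) (w : Site d → ℕ → Site d)
    (x y : Site d) : ℕ∞ :=
  ⨅ (n : ℕ) (_ : n < L x ∧ w x n = y), (n : ℕ∞)

/-- The time at which the particle from `x` is activated (`⊤` if it never is): the infimum of
the sums of passage times along finite sequences of sites from the origin to `x`. In particular
the particle from the origin is activated at time `0`. -/
noncomputable def activationTime {d : ℕ} (L : Site d → ℕ) (w : Site d → ℕ → Site d)
    (x : Site d) : ℕ∞ :=
  ⨅ (m : ℕ) (p : ℕ → Site d) (_ : p 0 = 0 ∧ p m = x),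
    ∑ i ∈ Finset.range m, passageTime L w (p i) (p (i + 1))

/-- The set of times at which some active particle is at the origin. -/
def visitTimes {d : ℕ} (L : Site d → ℕ) (w : Site d → ℕ → Site d) : Set ℕ :=
  {t | ∃ (x : Site d) (n : ℕ), n < L x ∧ w x n = 0 ∧ activationTime L w x + n = t}

/-- Recurrence: with positive probability the origin is hit infinitely often. -/
def IsRecurrent {d : ℕ} {Ω : Type*} [MeasurableSpace Ω] (P : Measure Ω)
    (Ξ : Site d → Ω → ℕ) (S : Site d → ℕ → Ω → Site d) : Prop :=
  0 < P {ω | (visitTimes (fun x => Ξ x ω) (fun x n => S x n ω)).Infinite}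

end FrogModel

/-! Let `B k` be the ball of squared radius `lam ^ k`, with `lam` slightly above 1, and suppose all
its particles are active. Within a time `N` of order `lam ^ k`, the particle from `x` hits `y` with
probability at least the tail of the lifetime law at `N` times `green N (y - x) / green N 0`
(`green_le_mul_hit`). Summed over `x` in the ball, `green N (y - x)` is the expected time that a
walk from `y` spends in the ball, which is at least `c * lam ^ k` even for `y` in the next ball
(`exists_occupation_lower_bound`). Upper bounds for `green N 0` (a square root, a logarithm or a
constant, for dimension 1, 2 or at least 3) come from explicit functions with a drift at the origin.
With the assumed tails, the expected number of hits of `y` is then a large multiple of the logarithm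
of the radius, or of its iterated logarithm in dimension one.

By independence, `y` is missed with probability at most the exponential of minus this number. A
union bound over all sites of the next ball is summable over `k`. In dimension one only the origin
and the two endpoints need to be hit, as paths cannot jump over sites, so an iterated logarithm
suffices.

Recurrence follows by Borel–Cantelli (`isRecurrent_of_summable`). With positive probability the
origin's particle covers some `B K` and, independently, the other particles never fail from scale
`K` on, so every site is activated. Discarding finitely many particles preserves summability, so the
origin is hit by particles from outside every finite set. Since activation spreads at bounded speed,
these visits occur at infinitely many times (`visitTimes_infinite`). -/

namespace FrogModel

/-! ### Transition operator, Green function and moments of the walk -/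

/-- The transition operator of simple random walk on `ℤ^d`. -/
noncomputable def avg (d : ℕ) : Module.End ℝ (Site d → ℝ) where
  toFun f x := (2 * (d : ℝ))⁻¹ * ∑ i, (f (x + Pi.single i 1) + f (x - Pi.single i 1))
  map_add' f g := by
    ext x
    simp only [Pi.add_apply, ← mul_add, ← Finset.sum_add_distrib]
    congr 1
    exact Finset.sum_congr rfl fun i _ => by ring
  map_smul' c f := by
    ext x
    simp only [Pi.smul_apply, smul_eq_mul, RingHom.id_apply, ← mul_add, ← Finset.mul_sum]
    ring

variable {d : ℕ}

lemma avg_apply (f : Site d → ℝ) (x : Site d) :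
    avg d f x = (2 * (d : ℝ))⁻¹ * ∑ i, (f (x + Pi.single i 1) + f (x - Pi.single i 1)) := rfl

lemma avg_mono : Monotone (avg d) := by
  intro f g h x
  simp only [avg_apply]
  exact mul_le_mul_of_nonneg_left (Finset.sum_le_sum fun i _ => add_le_add (h _) (h _))
    (by positivity)

lemma avg_pow_mono (n : ℕ) : Monotone (avg d ^ n) := by
  induction n with
  | zero => exact fun f g h => h
  | succ n ih => rw [pow_succ]; exact fun f g h => ih (avg_mono h)

lemma avg_pow_nonneg (n : ℕ) {f : Site d → ℝ} (hf : 0 ≤ f) : 0 ≤ (avg d ^ n) f := by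
  simpa using avg_pow_mono n hf

lemma avg_const (hd : 1 ≤ d) (c : ℝ) : avg d (fun _ => c) = fun _ => c := by
  ext x
  have : (d : ℝ) ≠ 0 := by positivity
  simp only [avg_apply, Finset.sum_const, Finset.card_univ, Fintype.card_fin, nsmul_eq_mul]
  field_simp
  ring

lemma avg_pow_const (hd : 1 ≤ d) (n : ℕ) (c : ℝ) : (avg d ^ n) (fun _ => c) = fun _ => c := by
  induction n with
  | zero => rfl
  | succ n ih => rw [pow_succ, Module.End.mul_apply, avg_const hd, ih]

lemma avg_translate (f : Site d → ℝ) (y : Site d) :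
    avg d (fun x => f (y + x)) = fun x => avg d f (y + x) := by
  ext x
  simp only [avg_apply, add_assoc, add_sub_assoc]

lemma avg_pow_translate (n : ℕ) (f : Site d → ℝ) (y : Site d) :
    (avg d ^ n) (fun x => f (y + x)) = fun x => (avg d ^ n) f (y + x) := by
  induction n generalizing f with
  | zero => rfl
  | succ n ih => simp only [pow_succ, Module.End.mul_apply, avg_translate, ih]

lemma avg_reflect (f : Site d → ℝ) (y : Site d) :
    avg d (fun x => f (y - x)) = fun x => avg d f (y - x) := by
  ext x
  simp only [avg_apply]
  congr 1
  refine Finset.sum_congr rfl fun i _ => ?_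
  rw [add_comm, sub_sub_eq_add_sub, sub_add_eq_sub_sub, add_sub_right_comm]

/-- The expected number of visits to the site `0` before time `N`, as a function of the starting
point. -/
noncomputable def green (N : ℕ) : Site d → ℝ :=
  ∑ j ∈ Finset.range N, (avg d ^ j) (Pi.single 0 1)

lemma single_nonneg : (0 : Site d → ℝ) ≤ Pi.single 0 1 := by simp

lemma green_nonneg (N : ℕ) : (0 : Site d → ℝ) ≤ green N :=
  Finset.sum_nonneg fun j _ => avg_pow_nonneg j single_nonneg

lemma green_mono {M N : ℕ} (h : M ≤ N) : (green M : Site d → ℝ) ≤ green N :=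
  Finset.sum_le_sum_of_subset_of_nonneg (Finset.range_mono h)
    fun j _ _ => avg_pow_nonneg j single_nonneg

lemma green_succ (N : ℕ) : (green (N + 1) : Site d → ℝ) = Pi.single 0 1 + avg d (green N) := by
  simp only [green, Finset.sum_range_succ', map_sum, pow_succ', Module.End.mul_apply, pow_zero,
    Module.End.one_apply]
  rw [add_comm]

lemma one_le_green_zero {N : ℕ} (hN : 1 ≤ N) : 1 ≤ (green N : Site d → ℝ) 0 := by
  have := green_mono (d := d) hN 0
  simpa [green] using this

/-- By translation invariance the right-hand side is the expected time that one walk from `y` spends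
in `B`; this turns a sum over many particles into an occupation time. -/
lemma sum_green (N : ℕ) (B : Finset (Site d)) (y : Site d) :
    ∑ x ∈ B, green N (y - x) =
      ∑ j ∈ Finset.range N, (avg d ^ j) (fun x => if x ∈ B then 1 else 0) y := by
  simp only [green, Finset.sum_apply]
  rw [Finset.sum_comm]
  refine Finset.sum_congr rfl fun j _ => ?_
  have h : (fun z : Site d => if z ∈ B then (1 : ℝ) else 0) =
      ∑ x ∈ B, fun z => (Pi.single 0 1 : Site d → ℝ) (-x + z) := by
    ext z
    simp only [Finset.sum_apply, Pi.single_apply, neg_add_eq_zero]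
    simp
  rw [h, map_sum, Finset.sum_apply]
  refine Finset.sum_congr rfl fun x _ => ?_
  rw [avg_pow_translate]
  simp only [neg_add_eq_sub]

/-- A function with drift at least `c` at the origin controls the Green function there. -/
lemma mul_green_le {f : Site d → ℝ} {c : ℝ} (h : f + c • Pi.single 0 1 ≤ avg d f) (N : ℕ) :
    f + c • green N ≤ (avg d ^ N) f := by
  induction N with
  | zero => simp [green]
  | succ N ih =>
    have h1 := avg_pow_mono N h
    rw [map_add, map_smul, ← Module.End.mul_apply, ← pow_succ] at h1
    refine le_trans ?_ h1
    rw [green, Finset.sum_range_succ, smul_add, ← add_assoc]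
    exact add_le_add_left ih _

/-- The squared Euclidean norm. -/
def normSq (x : Site d) : ℝ := ∑ i, (x i : ℝ) ^ 2

lemma normSq_nonneg (x : Site d) : 0 ≤ normSq x := Finset.sum_nonneg fun _ _ => sq_nonneg _

lemma normSq_zero : normSq (0 : Site d) = 0 := by simp [normSq]

lemma normSq_add_single (x : Site d) (i : Fin d) :
    normSq (x + Pi.single i 1) = normSq x + 2 * x i + 1 := by
  have : ∀ j, ((x + Pi.single i 1 : Site d) j : ℝ) ^ 2 =
      (x j : ℝ) ^ 2 + (if j = i then 2 * (x j : ℝ) + 1 else 0) := by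
    intro j
    by_cases h : j = i
    · subst h; simp; ring
    · simp [h]
  simp only [normSq, this, Finset.sum_add_distrib, Finset.sum_ite_eq', Finset.mem_univ, if_true]
  ring

lemma normSq_sub_single (x : Site d) (i : Fin d) :
    normSq (x - Pi.single i 1) = normSq x - 2 * x i + 1 := by
  have := normSq_add_single (x - Pi.single i 1) i
  simp only [sub_add_cancel, Pi.sub_apply, Pi.single_eq_same] at this
  push_cast at this
  linarith

lemma avg_normSq (hd : 1 ≤ d) : avg d normSq = normSq + fun _ => 1 := by
  ext x
  have : (d : ℝ) ≠ 0 := by positivity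
  have h : ∀ i : Fin d, normSq x + 2 * (x i : ℝ) + 1 + (normSq x - 2 * (x i : ℝ) + 1)
      = 2 * (normSq x + 1) := fun i => by ring
  simp only [avg_apply, normSq_add_single, normSq_sub_single, Pi.add_apply, h, Finset.sum_const,
    Finset.card_univ, Fintype.card_fin, nsmul_eq_mul]
  field_simp

lemma avg_pow_normSq (hd : 1 ≤ d) (n : ℕ) : (avg d ^ n) normSq = normSq + fun _ => (n : ℝ) := by
  induction n with
  | zero => ext x; simp
  | succ n ih =>
    rw [pow_succ, Module.End.mul_apply, avg_normSq hd, map_add, ih, avg_pow_const hd]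
    ext x; simp [add_assoc]

/-- The exact coefficient of `normSq` is `2 + 4 / d`; 6 is its largest value, at `d = 1`. -/
lemma avg_normSq_sq_le (hd : 1 ≤ d) :
    avg d (fun x => normSq x ^ 2) ≤ (fun x => normSq x ^ 2) + (6 : ℝ) • normSq + fun _ => 1 := by
  intro x
  have hd' : (1 : ℝ) ≤ d := by exact_mod_cast hd
  have h : ∀ i : Fin d, (normSq x + 2 * (x i : ℝ) + 1) ^ 2 + (normSq x - 2 * (x i : ℝ) + 1) ^ 2
      = 2 * (normSq x + 1) ^ 2 + 8 * (x i : ℝ) ^ 2 := fun i => by ring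
  simp only [avg_apply, normSq_add_single, normSq_sub_single, Pi.add_apply, h, Pi.smul_apply,
    smul_eq_mul, Finset.sum_add_distrib, ← Finset.mul_sum, Finset.sum_const,
    Finset.card_univ, Fintype.card_fin, nsmul_eq_mul]
  change _ * (_ + 8 * normSq x) ≤ _
  rw [inv_mul_le_iff₀ (by positivity)]
  nlinarith [normSq_nonneg x]

lemma avg_pow_normSq_sq_le (hd : 1 ≤ d) (n : ℕ) :
    (avg d ^ n) (fun x => normSq x ^ 2) 0 ≤ 3 * (n : ℝ) ^ 2 := by
  induction n with
  | zero => simp [normSq_zero]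
  | succ n ih =>
    have h := avg_pow_mono n (avg_normSq_sq_le hd) 0
    rw [map_add, map_add, map_smul, avg_pow_normSq hd, avg_pow_const hd, ← Module.End.mul_apply,
      ← pow_succ] at h
    simp only [Pi.add_apply, Pi.smul_apply, normSq_zero, smul_eq_mul] at h
    push_cast
    nlinarith

/-- The inner product of a site with a real vector. -/
def dot (u : Fin d → ℝ) (x : Site d) : ℝ := ∑ i, u i * x i

lemma dot_add (u : Fin d → ℝ) (x y : Site d) : dot u (x + y) = dot u x + dot u y := by
  simp [dot, mul_add, Finset.sum_add_distrib]

lemma dot_sub (u : Fin d → ℝ) (x y : Site d) : dot u (x - y) = dot u x - dot u y := by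
  simp [dot, mul_sub, Finset.sum_sub_distrib]

lemma dot_single (u : Fin d → ℝ) (i : Fin d) : dot u (Pi.single i 1) = u i := by
  rw [dot, Finset.sum_eq_single i]
  · simp
  · intro j _ h; simp [h]
  · simp

lemma dot_zero (u : Fin d → ℝ) : dot u 0 = 0 := by simp [dot]

lemma avg_dot (hd : 1 ≤ d) (u : Fin d → ℝ) : avg d (dot u) = dot u := by
  ext x
  have : (d : ℝ) ≠ 0 := by positivity
  have h : ∀ i : Fin d, dot u x + u i + (dot u x - u i) = 2 * dot u x := fun i => by ring
  simp only [avg_apply, dot_add, dot_sub, dot_single, h, Finset.sum_const,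
    Finset.card_univ, Fintype.card_fin, nsmul_eq_mul]
  field_simp

lemma avg_pow_dot (hd : 1 ≤ d) (u : Fin d → ℝ) (n : ℕ) : (avg d ^ n) (dot u) = dot u := by
  induction n with
  | zero => rfl
  | succ n ih => rw [pow_succ, Module.End.mul_apply, avg_dot hd, ih]

lemma avg_pow_dot_sq (hd : 1 ≤ d) {u : Fin d → ℝ} (hu : ∑ i, u i ^ 2 = 1) (n : ℕ) :
    (avg d ^ n) (fun x => dot u x ^ 2) = (fun x => dot u x ^ 2) + fun _ => (n : ℝ) / d := by
  induction n with
  | zero => ext x; simp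
  | succ n ih =>
    have h1 : avg d (fun x => dot u x ^ 2) = (fun x => dot u x ^ 2) + fun _ => (1 : ℝ) / d := by
      ext x
      have : (d : ℝ) ≠ 0 := by positivity
      have h : ∀ i : Fin d, (dot u x + u i) ^ 2 + (dot u x - u i) ^ 2
          = 2 * dot u x ^ 2 + 2 * u i ^ 2 := fun i => by ring
      simp only [avg_apply, dot_add, dot_sub, dot_single, h, Finset.sum_add_distrib,
        ← Finset.mul_sum, hu, Finset.sum_const, Pi.add_apply,
        Finset.card_univ, Fintype.card_fin, nsmul_eq_mul]
      field_simp
    rw [pow_succ, Module.End.mul_apply, h1, map_add, ih, avg_pow_const hd]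
    ext x
    simp only [Pi.add_apply]
    push_cast
    ring

lemma dot_sq_le {u : Fin d → ℝ} (hu : ∑ i, u i ^ 2 = 1) (x : Site d) :
    dot u x ^ 2 ≤ normSq x := by
  have := Finset.sum_mul_sq_le_sq_mul_sq Finset.univ u (fun i => (x i : ℝ))
  rwa [hu, one_mul] at this

end FrogModel

/-! ### Upper bounds for the Green function at the origin -/

namespace FrogModel

variable {d : ℕ}

/-- The function `|x|` is subharmonic with drift 1 at the origin, so `mul_green_le` bounds the Green
function by the mean of `|x|` after `N` steps. The tangent inequality `hle` replaces Cauchy–Schwarz,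
so that only the mean of `normSq` is needed. -/
lemma green_zero_le_one_dim (N : ℕ) : (green N : Site 1 → ℝ) 0 ≤ Real.sqrt N := by
  rcases Nat.eq_zero_or_pos N with rfl | hN
  · simp [green]
  have hdrift : (fun x : Site 1 => |(x 0 : ℝ)|) + (1 : ℝ) • Pi.single 0 1 ≤
      avg 1 (fun x => |(x 0 : ℝ)|) := by
    intro x
    simp only [avg_apply, Pi.add_apply, Pi.smul_apply, smul_eq_mul, Finset.univ_unique,
      Fin.default_eq_zero, Finset.sum_singleton, Pi.sub_apply, Pi.single_eq_same]
    push_cast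
    by_cases hx : x = 0
    · subst hx; simp; norm_num
    · rw [Pi.single_eq_of_ne hx]
      have := abs_add_le ((x 0 : ℝ) + 1) (x 0 - 1)
      rw [show (x 0 : ℝ) + 1 + (x 0 - 1) = 2 * x 0 by ring, abs_mul, abs_two] at this
      linarith
  have hs : 0 < Real.sqrt N := Real.sqrt_pos.2 (by exact_mod_cast hN)
  have hss : Real.sqrt N * Real.sqrt N = N := Real.mul_self_sqrt (by positivity)
  have hle : (fun x : Site 1 => |(x 0 : ℝ)|) ≤
      (2 * Real.sqrt N)⁻¹ • normSq + fun _ => Real.sqrt N / 2 := by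
    intro x
    have h1 : normSq x = |(x 0 : ℝ)| ^ 2 := by simp [normSq]
    simp only [Pi.add_apply, Pi.smul_apply, smul_eq_mul, h1]
    have : |(x 0 : ℝ)| * (2 * Real.sqrt N) ≤ |(x 0 : ℝ)| ^ 2 + Real.sqrt N * Real.sqrt N := by
      nlinarith [sq_nonneg (|(x 0 : ℝ)| - Real.sqrt N)]
    field_simp
    nlinarith
  have h1 := mul_green_le hdrift N 0
  have h2 := avg_pow_mono N hle 0
  rw [map_add, map_smul, avg_pow_normSq le_rfl, avg_pow_const le_rfl] at h2
  simp only [Pi.add_apply, Pi.smul_apply, smul_eq_mul, Pi.zero_apply, Int.cast_zero, abs_zero,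
    zero_add, one_mul, normSq_zero] at h1 h2
  refine h1.trans (h2.trans (le_of_eq ?_))
  rw [← hss]
  field_simp
  simp
  ring

/-- This is subharmonicity of `log (1 + normSq)` on the square lattice. After exponentiation, the
difference of the two sides is a polynomial with visibly nonnegative terms. -/
lemma log_drift_two_dim {a b : ℝ} :
    4 * Real.log (1 + (a ^ 2 + b ^ 2)) ≤
      Real.log (1 + (a ^ 2 + b ^ 2 + 2 * a + 1)) + Real.log (1 + (a ^ 2 + b ^ 2 - 2 * a + 1)) +
      (Real.log (1 + (a ^ 2 + b ^ 2 + 2 * b + 1)) +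
        Real.log (1 + (a ^ 2 + b ^ 2 - 2 * b + 1))) := by
  have p1 : 0 < 1 + (a ^ 2 + b ^ 2 + 2 * a + 1) := by nlinarith [sq_nonneg (a + 1), sq_nonneg b]
  have p2 : 0 < 1 + (a ^ 2 + b ^ 2 - 2 * a + 1) := by nlinarith [sq_nonneg (a - 1), sq_nonneg b]
  have p3 : 0 < 1 + (a ^ 2 + b ^ 2 + 2 * b + 1) := by nlinarith [sq_nonneg (b + 1), sq_nonneg a]
  have p4 : 0 < 1 + (a ^ 2 + b ^ 2 - 2 * b + 1) := by nlinarith [sq_nonneg (b - 1), sq_nonneg a]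
  rw [← Real.log_mul p1.ne' p2.ne', ← Real.log_mul p3.ne' p4.ne',
    ← Real.log_mul (mul_pos p1 p2).ne' (mul_pos p3 p4).ne']
  rw [show (4 : ℝ) * Real.log (1 + (a ^ 2 + b ^ 2)) = Real.log ((1 + (a ^ 2 + b ^ 2)) ^ 4) by
    rw [Real.log_pow]; norm_num]
  refine Real.log_le_log (by positivity) ?_
  have ha := sq_nonneg a
  have hb := sq_nonneg b
  have : (1 + (a ^ 2 + b ^ 2 + 2 * a + 1)) * (1 + (a ^ 2 + b ^ 2 - 2 * a + 1)) *
      ((1 + (a ^ 2 + b ^ 2 + 2 * b + 1)) * (1 + (a ^ 2 + b ^ 2 - 2 * b + 1))) -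
      (1 + (a ^ 2 + b ^ 2)) ^ 4 = 2 * (1 + (a ^ 2 + b ^ 2)) ^ 2 + 8 * (1 + (a ^ 2 + b ^ 2)) + 5
        + 16 * (a * b) ^ 2 := by
    ring
  have : 0 ≤ 2 * (1 + (a ^ 2 + b ^ 2)) ^ 2 + 8 * (1 + (a ^ 2 + b ^ 2)) + 5
        + 16 * (a * b) ^ 2 := by positivity
  linarith

/-- The drift function is `log (1 + normSq)`, whose drift at the origin is `log 2`. The tangent of
the logarithm at `1 + N` plays the role of Jensen's inequality. -/
lemma green_zero_le_two_dim (N : ℕ) :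
    Real.log 2 * (green N : Site 2 → ℝ) 0 ≤ Real.log (1 + N) := by
  have hdrift : (fun x : Site 2 => Real.log (1 + normSq x)) + Real.log 2 • Pi.single 0 1 ≤
      avg 2 (fun x => Real.log (1 + normSq x)) := by
    intro x
    simp only [avg_apply, Pi.add_apply, Pi.smul_apply, smul_eq_mul, normSq_add_single,
      normSq_sub_single, Fin.sum_univ_two]
    by_cases hx : x = 0
    · subst hx
      simp [normSq_zero]
      norm_num
      linarith
    · rw [Pi.single_eq_of_ne hx]
      have := log_drift_two_dim (a := x 0) (b := x 1)
      simp only [normSq, Fin.sum_univ_two]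
      push_cast
      linarith
  have hle : (fun x : Site 2 => Real.log (1 + normSq x)) ≤
      (1 + (N : ℝ))⁻¹ • normSq + fun _ => Real.log (1 + N) - N / (1 + N) := by
    intro x
    have hN : (0 : ℝ) < 1 + N := by positivity
    have hx := normSq_nonneg x
    have := Real.log_le_sub_one_of_pos (x := (1 + normSq x) / (1 + N)) (by positivity)
    rw [Real.log_div (by positivity) hN.ne'] at this
    simp only [Pi.add_apply, Pi.smul_apply, smul_eq_mul]
    have h2 : (1 + normSq x) / (1 + N) - 1 = (1 + (N : ℝ))⁻¹ * normSq x - N / (1 + N) := by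
      field_simp
      ring
    linarith
  have h1 := mul_green_le hdrift N 0
  have h2 := avg_pow_mono N hle 0
  rw [map_add, map_smul, avg_pow_normSq one_le_two, avg_pow_const one_le_two] at h2
  simp only [Pi.add_apply, Pi.smul_apply, smul_eq_mul, normSq_zero, add_zero, Real.log_one,
    zero_add] at h1 h2
  refine h1.trans (h2.trans (le_of_eq ?_))
  field_simp
  ring

/-- A second-order Taylor bound: the true coefficient is `5 / 32`, and the excess of `17 / 100`
absorbs the remainder. Taking fourth powers makes the claim polynomial. -/
lemma one_add_rpow_neg_quarter_le {s : ℝ} (hs : |s| ≤ 1 / 20) :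
    (1 + s) ^ (-(1 / 4) : ℝ) ≤ 1 - s / 4 + 17 / 100 * s ^ 2 := by
  obtain ⟨h1, h2⟩ := abs_le.1 hs
  have hp : 0 < 1 + s := by linarith
  have hq : 0 ≤ 1 - s / 4 + 17 / 100 * s ^ 2 := by nlinarith [sq_nonneg s]
  have hpoly : 1 ≤ (1 + s) * (1 - s / 4 + 17 / 100 * s ^ 2) ^ 4 := by
    have horner : ∀ {c w : ℝ}, |c| ≤ 19 / 20 → |w| ≤ 1 → |c + s * w| ≤ 1 := by
      intro c w hc hw
      have := abs_add_le c (s * w)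
      rw [abs_mul] at this
      nlinarith [abs_nonneg w, abs_nonneg s]
    -- These are the coefficients of degree three and higher in the product, in Horner form; since
    -- `|s| ≤ 1 / 20`, their contribution `s * w` is below the margin `11 / 200`.
    have key : |193 / 400 + s * (-42831 / 160000 + s * (33197 / 160000 + s * (-133671 / 2000000 +
        s * (51153 / 2000000 + s * (-407779 / 100000000 + s * (83521 / 100000000))))))| ≤ 1 := by
      refine horner (by norm_num [abs_le]) (horner (by norm_num [abs_le]) (horner
        (by norm_num [abs_le]) (horner (by norm_num [abs_le]) (horner (by norm_num [abs_le])
        (horner (by norm_num [abs_le]) (by norm_num [abs_le]))))))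
    set w := 193 / 400 + s * (-42831 / 160000 + s * (33197 / 160000 + s * (-133671 / 2000000 +
        s * (51153 / 2000000 + s * (-407779 / 100000000 + s * (83521 / 100000000)))))) with hw
    have h3 : (1 + s) * (1 - s / 4 + 17 / 100 * s ^ 2) ^ 4 = 1 + s ^ 2 * (11 / 200 + s * w) := by
      rw [hw]; ring
    have h4 : |s * w| ≤ 1 / 20 := by
      rw [abs_mul]
      nlinarith [abs_nonneg w, abs_nonneg s]
    have h5 : 0 ≤ 11 / 200 + s * w := by linarith [(abs_le.1 h4).1]
    rw [h3]
    nlinarith [sq_nonneg s]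
  have h6 : (1 + s)⁻¹ ≤ (1 - s / 4 + 17 / 100 * s ^ 2) ^ 4 := by
    rwa [inv_le_iff_one_le_mul₀' hp]
  rw [Real.rpow_neg hp.le, ← Real.inv_rpow hp.le]
  calc (1 + s)⁻¹ ^ (1 / 4 : ℝ) ≤ ((1 - s / 4 + 17 / 100 * s ^ 2) ^ 4) ^ (1 / 4 : ℝ) :=
        Real.rpow_le_rpow (by positivity) h6 (by norm_num)
    _ = _ := by
        rw [← Real.rpow_natCast, ← Real.rpow_mul hq]
        norm_num

/-- The superharmonic function `(10000 + ∑ i ∈ I, x i ^ 2) ^ (-1 / 4)` for three coordinates. -/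
noncomputable def potential (I : Finset (Fin d)) (x : Site d) : ℝ :=
  (10000 + ∑ i ∈ I, (x i : ℝ) ^ 2) ^ (-(1 / 4) : ℝ)

lemma sum_sq_add_single (I : Finset (Fin d)) (x : Site d) (i : Fin d) :
    ∑ j ∈ I, ((x + Pi.single i 1 : Site d) j : ℝ) ^ 2 =
      ∑ j ∈ I, (x j : ℝ) ^ 2 + if i ∈ I then 2 * (x i : ℝ) + 1 else 0 := by
  have : ∀ j, ((x + Pi.single i 1 : Site d) j : ℝ) ^ 2 =
      (x j : ℝ) ^ 2 + (if j = i then 2 * (x j : ℝ) + 1 else 0) := by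
    intro j
    by_cases h : j = i
    · subst h; simp; ring
    · simp [h]
  simp only [this, Finset.sum_add_distrib, Finset.sum_ite_eq']

lemma sum_sq_sub_single (I : Finset (Fin d)) (x : Site d) (i : Fin d) :
    ∑ j ∈ I, ((x - Pi.single i 1 : Site d) j : ℝ) ^ 2 =
      ∑ j ∈ I, (x j : ℝ) ^ 2 + if i ∈ I then -2 * (x i : ℝ) + 1 else 0 := by
  have := sum_sq_add_single I (x - Pi.single i 1) i
  simp only [sub_add_cancel, Pi.sub_apply, Pi.single_eq_same] at this ⊢
  rw [this]
  split_ifs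
  · push_cast; ring
  · ring

lemma potential_nonneg (I : Finset (Fin d)) (x : Site d) : 0 ≤ potential I x :=
  Real.rpow_nonneg (add_nonneg (by norm_num) (Finset.sum_nonneg fun _ _ => sq_nonneg _)) _

lemma rpow_neg_quarter_pair_le {u a : ℝ} (hu : 10000 ≤ u) (ha : a ^ 2 ≤ u) :
    (u + (2 * a + 1)) ^ (-(1 / 4) : ℝ) + (u + (-2 * a + 1)) ^ (-(1 / 4) : ℝ) ≤
      u ^ (-(1 / 4) : ℝ) * (2 - (1 / 2) / u + (34 / 100 + 136 / 100 * a ^ 2) / u ^ 2) := by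
  have hu0 : 0 < u := by linarith
  have hs : ∀ b : ℝ, b ^ 2 ≤ u → (u + (2 * b + 1)) ^ (-(1 / 4) : ℝ) ≤
      u ^ (-(1 / 4) : ℝ) * (1 - (2 * b + 1) / u / 4 + 17 / 100 * ((2 * b + 1) / u) ^ 2) := by
    intro b hb
    have h1 : |(2 * b + 1) / u| ≤ 1 / 20 := by
      refine abs_le_of_sq_le_sq ?_ (by norm_num)
      rw [div_pow, div_le_iff₀ (by positivity)]
      nlinarith [sq_nonneg (2 * b - 1)]
    have h2 : u + (2 * b + 1) = u * (1 + (2 * b + 1) / u) := by field_simp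
    rw [h2, Real.mul_rpow hu0.le (by linarith [(abs_le.1 h1).1])]
    exact mul_le_mul_of_nonneg_left (one_add_rpow_neg_quarter_le h1) (by positivity)
  have h1 := hs a ha
  have h2 := hs (-a) (by simpa using ha)
  rw [show 2 * -a = -2 * a by ring] at h2
  refine (add_le_add h1 h2).trans (le_of_eq ?_)
  rw [← mul_add]
  congr 1
  field_simp
  ring

/-- Only steps in the three coordinates of `I` matter. To leading order they contribute `(-3 / 2 +
136 / 100) / u` in total, which is negative with room for `-(1 / 10) / u`. The offset 10000 keeps
the relative change of `u` in one step below `1 / 20`, as the Taylor bound requires. -/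
lemma avg_potential_le (I : Finset (Fin d)) (hI : I.card = 3) (x : Site d) :
    avg d (potential I) x ≤ potential I x - (2 * (d : ℝ))⁻¹ *
      (potential I x * ((1 / 10) / (10000 + ∑ i ∈ I, (x i : ℝ) ^ 2))) := by
  have hd : 1 ≤ d := by
    obtain ⟨i, -⟩ := Finset.card_pos.1 (by omega : 0 < I.card)
    exact Nat.one_le_of_lt i.2
  have hd' : (d : ℝ) ≠ 0 := by positivity
  set u := 10000 + ∑ i ∈ I, (x i : ℝ) ^ 2 with hu
  have hsq : 0 ≤ ∑ i ∈ I, (x i : ℝ) ^ 2 := Finset.sum_nonneg fun _ _ => sq_nonneg _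
  have hu1 : 10000 ≤ u := by linarith
  have hu0 : 0 < u := by linarith
  have hterm : ∀ i : Fin d, potential I (x + Pi.single i 1) + potential I (x - Pi.single i 1) ≤
      2 * potential I x + if i ∈ I then u ^ (-(1 / 4) : ℝ) *
        (-(1 / 2) / u + (34 / 100 + 136 / 100 * (x i : ℝ) ^ 2) / u ^ 2) else 0 := by
    intro i
    simp only [potential, sum_sq_add_single, sum_sq_sub_single]
    rw [← add_assoc, ← add_assoc, ← hu]
    by_cases hi : i ∈ I
    · have h1 : (x i : ℝ) ^ 2 ≤ u := by
        have := Finset.single_le_sum (f := fun i => (x i : ℝ) ^ 2) (fun _ _ => sq_nonneg _) hi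
        linarith
      have := rpow_neg_quarter_pair_le hu1 h1
      simp only [hi, if_true]
      refine this.trans (le_of_eq ?_)
      ring
    · simp only [hi, if_false, add_zero]
      linarith
  have hsum := Finset.sum_le_sum fun i (_ : i ∈ Finset.univ) => hterm i
  have hrhs : ∑ i, (2 * potential I x + if i ∈ I then u ^ (-(1 / 4) : ℝ) *
        (-(1 / 2) / u + (34 / 100 + 136 / 100 * (x i : ℝ) ^ 2) / u ^ 2) else 0) =
      d * (2 * potential I x) + u ^ (-(1 / 4) : ℝ) * (3 * (-(1 / 2) / u) +
        (3 * (34 / 100 : ℝ) + 136 / 100 * ∑ i ∈ I, (x i : ℝ) ^ 2) / u ^ 2) := by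
    rw [Finset.sum_add_distrib, Finset.sum_ite_mem, Finset.univ_inter, ← Finset.mul_sum,
      ← Finset.mul_sum, Finset.sum_add_distrib, ← Finset.sum_div, ← Finset.sum_div,
      Finset.sum_add_distrib, ← Finset.mul_sum, Finset.sum_const, Finset.sum_const, Finset.sum_const, hI,
      Finset.card_univ, Fintype.card_fin]
    simp only [nsmul_eq_mul]
    ring
  rw [hrhs] at hsum
  have hI2 : ∑ i ∈ I, (x i : ℝ) ^ 2 = u - 10000 := by rw [hu]; ring
  have hfin : (3 * (-(1 / 2) / u) + (3 * (34 / 100 : ℝ) + 136 / 100 * (u - 10000)) / u ^ 2) ≤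
      -((1 / 10) / u) := by
    rw [← sub_nonneg]
    have : -((1 / 10) / u) - (3 * (-(1 / 2) / u) + (3 * (34 / 100) + 136 / 100 * (u - 10000))
        / u ^ 2) = (4 / 100 * u + 136 * 100 - 102 / 100) / u ^ 2 := by
      field_simp
      ring
    rw [this]
    exact div_nonneg (by linarith) (by positivity)
  rw [hI2] at hsum
  have hpot : potential I x = u ^ (-(1 / 4) : ℝ) := rfl
  have hpos : 0 ≤ u ^ (-(1 / 4) : ℝ) := by positivity
  have h2 := mul_le_mul_of_nonneg_left hfin hpos
  have h3 := mul_le_mul_of_nonneg_left (hsum.trans (add_le_add_right h2 _))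
    (by positivity : 0 ≤ (2 * (d : ℝ))⁻¹)
  rw [avg_apply]
  refine h3.trans (le_of_eq ?_)
  rw [hpot]
  field_simp
  ring

/-- The drift function is `-potential I`: it never exceeds 0, so the accumulated drift `c * green N
0` cannot exceed `potential I 0`. -/
lemma exists_green_zero_le (hd : 3 ≤ d) : ∃ C : ℝ, 0 < C ∧ ∀ N, (green N : Site d → ℝ) 0 ≤ C := by
  obtain ⟨I, -, hI⟩ := Finset.exists_subset_card_eq (s := (Finset.univ : Finset (Fin d)))
    (n := 3) (by simpa using hd)
  have hd0 : (0 : ℝ) < d := by positivity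
  set c : ℝ := (2 * (d : ℝ))⁻¹ * (potential I 0 * ((1 / 10) / 10000)) with hc
  have hp : 0 < potential I 0 := by simp only [potential]; simp; positivity
  have hc0 : 0 < c := by positivity
  have hdrift : -potential I + c • Pi.single 0 1 ≤ avg d (-potential I) := by
    intro x
    have h := avg_potential_le I hI x
    simp only [map_neg, Pi.add_apply, Pi.neg_apply, Pi.smul_apply, smul_eq_mul]
    by_cases hx : x = 0
    · subst hx
      simp only [Pi.zero_apply, Int.cast_zero, ne_eq, OfNat.ofNat_ne_zero, not_false_eq_true,
        zero_pow, Finset.sum_const_zero, add_zero] at h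
      simp only [Pi.single_eq_same, mul_one]
      linarith
    · rw [Pi.single_eq_of_ne hx]
      have : 0 ≤ (2 * (d : ℝ))⁻¹ *
          (potential I x * ((1 / 10) / (10000 + ∑ i ∈ I, (x i : ℝ) ^ 2))) := by
        have := potential_nonneg I x
        have : 0 ≤ ∑ i ∈ I, (x i : ℝ) ^ 2 := Finset.sum_nonneg fun _ _ => sq_nonneg _
        positivity
      linarith
  refine ⟨potential I 0 / c, by positivity, fun N => ?_⟩
  have h1 := mul_green_le hdrift N 0
  have h2 := avg_pow_nonneg N (f := potential I) (fun x => potential_nonneg I x) 0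
  simp only [map_neg, Pi.add_apply, Pi.neg_apply, Pi.smul_apply, smul_eq_mul,
    Pi.zero_apply] at h1 h2
  rw [le_div_iff₀ hc0]
  linarith

end FrogModel

/-! ### Occupation time of a ball from a starting point slightly outside it -/

namespace FrogModel

variable {d : ℕ}

/-- Multiply `3 * v - v ^ 3 ≤ 2` at `v = k * |t|` by `|t|`. It bounds a first absolute moment from
below by second and fourth moments, which are explicit for the walk. -/
lemma abs_ge_of_pow_four (t : ℝ) {k : ℝ} (hk : 0 < k) :
    (3 * k * t ^ 2 - k ^ 3 * t ^ 4) / 2 ≤ |t| := by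
  have h : ∀ v : ℝ, 0 ≤ v → 3 * v - v ^ 3 ≤ 2 := fun v hv => by
    nlinarith [mul_nonneg (add_nonneg hv zero_le_two) (sq_nonneg (v - 1))]
  have h1 := h (k * |t|) (by positivity)
  have h2 : t ^ 2 = |t| ^ 2 := (sq_abs t).symm
  have h4 : t ^ 4 = |t| ^ 4 := (Even.pow_abs (by decide) t).symm
  rw [h2, h4]
  nlinarith [abs_nonneg t]

/-- A pointwise lower bound, by functions with explicit expectation, for the indicator that a walk
moves in direction `-u` without going too far. -/
lemma indicator_ge {a k σ s Q : ℝ} (ha : 0 < a) (hk : 0 < k) (hσ : 0 < σ) (hQ : s ^ 2 ≤ Q) :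
    3 * k / (4 * σ) * s ^ 2 - k ^ 3 / (4 * σ ^ 3) * Q ^ 2 - s / 2 - a * σ - a / σ * Q ≤
      σ / a * (if s ≤ -(a * σ) ∧ Q ≤ (σ / a) ^ 2 then 1 else 0) := by
  have hQ0 : 0 ≤ Q := (sq_nonneg s).trans hQ
  -- The right-hand side is the negative part of `s`; for mean-zero `s` its expectation is half that
  -- of `|s|`.
  have hneg : 3 * k / (4 * σ) * s ^ 2 - k ^ 3 / (4 * σ ^ 3) * Q ^ 2 - s / 2 ≤ (|s| - s) / 2 := by
    have h1 := abs_ge_of_pow_four s (k := k / σ) (by positivity)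
    have h2 : s ^ 4 ≤ Q ^ 2 := by nlinarith [sq_nonneg s]
    have h3 : 3 * k / (4 * σ) * s ^ 2 - k ^ 3 / (4 * σ ^ 3) * s ^ 4 =
        (3 * (k / σ) * s ^ 2 - (k / σ) ^ 3 * s ^ 4) / 2 / 2 := by
      field_simp
      ring
    have h4 : k ^ 3 / (4 * σ ^ 3) * s ^ 4 ≤ k ^ 3 / (4 * σ ^ 3) * Q ^ 2 :=
      mul_le_mul_of_nonneg_left h2 (by positivity)
    linarith
  have hsQ : |s| ≤ Real.sqrt Q := Real.abs_le_sqrt hQ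
  have haQ : 0 ≤ a / σ * Q := by positivity
  have haσ : 0 < a * σ := by positivity
  have habs : (|s| - s) / 2 ≤ |s| := by linarith [neg_abs_le s]
  split_ifs with h
  · have : Real.sqrt Q ≤ σ / a := Real.sqrt_le_iff.2 ⟨by positivity, h.2⟩
    linarith
  · rw [not_and_or, not_le, not_le] at h
    rcases h with h | h
    · rcases le_total 0 s with hs | hs
      · rw [abs_of_nonneg hs] at hneg
        linarith
      · rw [abs_of_nonpos hs] at hneg
        linarith
    -- When `Q` is too large, the penalty `a / σ * Q` already exceeds `√Q ≥ |s|`.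
    · have h1 : σ / a ≤ Real.sqrt Q := Real.le_sqrt_of_sq_le h.le
      have h2 : Real.sqrt Q ≤ a / σ * Q := by
        rw [div_le_iff₀ ha] at h1
        have h3 : a / σ * Q = Real.sqrt Q * (Real.sqrt Q * a) / σ := by
          conv_lhs => rw [← Real.mul_self_sqrt hQ0]
          ring
        rw [h3, le_div_iff₀ hσ]
        exact mul_le_mul_of_nonneg_left h1 (Real.sqrt_nonneg _)
      linarith

/-- Take expectations in `indicator_ge`, with `s = dot u x` (mean 0, variance `j / d`) and `Q =
normSq x`. For `k = 1 / (2 * d)` the main term is `6 * a * σ`; the fourth-moment term costs at most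
`3 / 2 * a * σ` and the two penalties `a * σ` each, leaving more than `2 * a * σ`. -/
lemma directed_move_prob (hd : 1 ≤ d) {u : Fin d → ℝ} (hu : ∑ i, u i ^ 2 = 1) {a : ℝ}
    (ha : a = 1 / (16 * (d : ℝ) ^ 2)) {j : ℕ} (hj : 1 ≤ j) :
    2 * a ^ 2 ≤ (avg d ^ j) (fun x => if dot u x ≤ -(a * Real.sqrt j) ∧
      normSq x ≤ (Real.sqrt j / a) ^ 2 then 1 else 0) 0 := by
  have hd0 : (1 : ℝ) ≤ d := by exact_mod_cast hd
  set σ := Real.sqrt j with hσdef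
  have hσ : 0 < σ := Real.sqrt_pos.2 (by exact_mod_cast hj)
  have hσ2 : (j : ℝ) = σ ^ 2 := (Real.sq_sqrt (by positivity)).symm
  have ha0 : 0 < a := by rw [ha]; positivity
  set k : ℝ := 1 / (2 * d) with hk
  have hk0 : 0 < k := by positivity
  set f : Site d → ℝ := fun x => if dot u x ≤ -(a * σ) ∧ normSq x ≤ (σ / a) ^ 2 then 1 else 0
    with hf
  have hle : (3 * k / (4 * σ)) • (fun x : Site d => dot u x ^ 2) -
      (k ^ 3 / (4 * σ ^ 3)) • (fun x : Site d => normSq x ^ 2) - (1 / 2 : ℝ) • dot u -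
      (fun _ => a * σ) - (a / σ) • normSq ≤ (σ / a) • f := by
    intro x
    have := indicator_ge (a := a) (k := k) ha0 hk0 hσ (dot_sq_le hu x)
    simp only [Pi.sub_apply, Pi.smul_apply, smul_eq_mul, hf]
    linarith
  have h := avg_pow_mono j hle 0
  simp only [map_sub, map_smul] at h
  rw [avg_pow_dot_sq hd hu, avg_pow_dot hd, avg_pow_const hd, avg_pow_normSq hd] at h
  simp only [Pi.sub_apply, Pi.add_apply, Pi.smul_apply, smul_eq_mul, dot_zero, normSq_zero] at h
  have h4 := mul_le_mul_of_nonneg_left (avg_pow_normSq_sq_le hd j)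
    (by positivity : 0 ≤ k ^ 3 / (4 * σ ^ 3))
  rw [hσ2] at h h4
  have hk3 : k ^ 3 ≤ k / (4 * d) := by
    have : k ^ 3 = k / (4 * d) * (1 / d) := by rw [hk]; field_simp; norm_num
    rw [this]
    have : 1 / (d : ℝ) ≤ 1 := by rw [div_le_one (by positivity)]; exact hd0
    exact mul_le_of_le_one_right (by positivity) this
  have e1 : k / d = 8 * a := by rw [hk, ha]; field_simp; norm_num
  have h5 : k ^ 3 / (4 * σ ^ 3) * (3 * (σ ^ 2) ^ 2) ≤ 3 / 2 * a * σ := by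
    have : k ^ 3 / (4 * σ ^ 3) * (3 * (σ ^ 2) ^ 2) = 3 / 4 * k ^ 3 * σ := by field_simp
    rw [this]
    have : k / (4 * d) = 2 * a := by rw [← div_div, div_right_comm, e1]; ring
    nlinarith
  have h6 : 3 * k / (4 * σ) * (0 ^ 2 + σ ^ 2 / d) = 6 * a * σ := by
    have : 3 * k / (4 * σ) * (0 ^ 2 + σ ^ 2 / d) = 3 / 4 * (k / d) * σ := by
      field_simp
      ring
    rw [this, e1]; ring
  have h7 : a / σ * (0 + σ ^ 2) = a * σ := by field_simp; ring
  rw [h6, h7] at h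
  have haσ : 0 < a * σ := by positivity
  have h8 : 2 * a * σ ≤ σ / a * (avg d ^ j) f 0 := by linarith
  have h9 : σ / a * (2 * a ^ 2) = 2 * a * σ := by field_simp
  rw [← h9] at h8
  exact le_of_mul_le_mul_left h8 (by positivity)

lemma exists_unit_direction (hd : 1 ≤ d) (y : Site d) :
    ∃ (u : Fin d → ℝ), ∑ i, u i ^ 2 = 1 ∧
      ∀ x, normSq (y + x) = normSq y + 2 * Real.sqrt (normSq y) * dot u x + normSq x := by
  have hexp : ∀ x, normSq (y + x) = normSq y + 2 * ∑ i, (y i : ℝ) * x i + normSq x := by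
    intro x
    simp only [normSq, Finset.mul_sum, ← Finset.sum_add_distrib]
    refine Finset.sum_congr rfl fun i _ => ?_
    simp only [Pi.add_apply]
    push_cast
    ring
  rcases (normSq_nonneg y).eq_or_lt with h | h
  · refine ⟨Pi.single ⟨0, hd⟩ 1, ?_, fun x => ?_⟩
    · rw [Finset.sum_eq_single ⟨0, hd⟩] <;> simp +contextual
    · have h0 : ∀ i, (y i : ℝ) = 0 := by
        intro i
        have := (Finset.sum_eq_zero_iff_of_nonneg fun i _ => sq_nonneg ((y i : ℝ))).1 h.symm i
          (Finset.mem_univ i)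
        exact pow_eq_zero_iff two_ne_zero |>.1 this
      rw [hexp, ← h]
      simp [h0]
  · have hs : 0 < Real.sqrt (normSq y) := Real.sqrt_pos.2 h
    refine ⟨fun i => y i / Real.sqrt (normSq y), ?_, fun x => ?_⟩
    · simp only [div_pow, Real.sq_sqrt h.le, ← Finset.sum_div]
      exact div_self h.ne'
    · have : ∑ i, (y i : ℝ) * x i = Real.sqrt (normSq y) *
          dot (fun i => y i / Real.sqrt (normSq y)) x := by
        rw [dot, Finset.mul_sum]
        refine Finset.sum_congr rfl fun i _ => ?_
        field_simp
      rw [hexp, this]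
      ring

/-- Write `σ = θ * a ^ 3 * R` with `θ` between `1 / 2` and 1. Near the boundary, the inward move
gains about `2 * θ * a ^ 4 * R ^ 2` and the spread costs at most `θ ^ 2 * a ^ 4 * R ^ 2`. As `2 * θ
- θ ^ 2 ≥ 3 / 4`, a starting point outside the ball by the margin `3 / 4 * a ^ 4` is brought inside.
-/
lemma sq_radius_after_directed_move {a R r σ s Q : ℝ} (ha0 : 0 < a) (ha1 : a ≤ 1 / 16) (hR0 : 0 < R)
    (hr0 : 0 ≤ r) (hσ0 : 0 ≤ σ) (hy : r ^ 2 ≤ (1 + 3 / 4 * a ^ 4) * R ^ 2)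
    (hj0 : a ^ 6 * R ^ 2 / 4 ≤ σ ^ 2) (hj1 : σ ^ 2 ≤ a ^ 6 * R ^ 2) (hs : s ≤ -(a * σ))
    (hQ : Q ≤ (σ / a) ^ 2) : r ^ 2 + 2 * r * s + Q ≤ R ^ 2 := by
  have ha2 : a ^ 2 ≤ 1 / 256 := by nlinarith
  have ha4 : a ^ 4 ≤ 1 / 16 := by nlinarith
  obtain ⟨θ, hθ⟩ : ∃ θ : ℝ, σ = θ * (a ^ 3 * R) := ⟨σ / (a ^ 3 * R), by field_simp⟩
  have haR : 0 < a ^ 3 * R := by positivity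
  have hθ0 : 0 ≤ θ := by
    by_contra hneg
    rw [not_le] at hneg
    have := mul_neg_of_neg_of_pos hneg haR
    linarith
  have hθ1 : θ ≤ 1 := by
    by_contra hgt
    rw [not_le] at hgt
    have : (a ^ 3 * R) ^ 2 < σ ^ 2 := by
      rw [hθ]; exact pow_lt_pow_left₀ (by nlinarith) haR.le two_ne_zero
    nlinarith
  have hθ2 : 1 / 2 ≤ θ := by
    by_contra hlt
    rw [not_le] at hlt
    have : σ ^ 2 < (1 / 2 * (a ^ 3 * R)) ^ 2 := by
      refine pow_lt_pow_left₀ ?_ hσ0 two_ne_zero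
      rw [hθ]; exact mul_lt_mul_of_pos_right hlt haR
    nlinarith
  have hQ' : (σ / a) ^ 2 = θ ^ 2 * (a ^ 4 * R ^ 2) := by rw [hθ]; field_simp
  rw [hQ'] at hQ
  have hs' : 2 * r * s ≤ -(2 * θ * a ^ 4 * (r * R)) := by
    have := mul_le_mul_of_nonneg_left hs (by positivity : 0 ≤ 2 * r)
    rw [hθ] at this
    linarith
  have ha4p := pow_pos ha0 4
  clear hs hj0 hj1 ha2 hθ
  generalize a ^ 4 = b at *
  suffices r ^ 2 - 2 * θ * b * (r * R) + θ ^ 2 * (b * R ^ 2) ≤ R ^ 2 by linarith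
  rcases le_total r R with hrR | hrR
  · have e1 : r ^ 2 ≤ r * R := by nlinarith
    have e2 : r * R ≤ R * R := by nlinarith
    have e3 : 2 * θ * b ≤ 1 := by nlinarith
    have e4 : (1 - 2 * θ * b) * (r * R) ≤ (1 - 2 * θ * b) * (R * R) :=
      mul_le_mul_of_nonneg_left e2 (by linarith)
    have e5 : θ ^ 2 * (b * R ^ 2) ≤ 2 * θ * (b * R ^ 2) :=
      mul_le_mul_of_nonneg_right (by nlinarith) (by positivity)
    nlinarith
  · have e1 : R * R ≤ r * R := by nlinarith
    have e2 : 2 * θ * b * (R * R) ≤ 2 * θ * b * (r * R) :=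
      mul_le_mul_of_nonneg_left e1 (by positivity)
    have e3 : 3 / 4 * (b * R ^ 2) ≤ (2 * θ - θ ^ 2) * (b * R ^ 2) :=
      mul_le_mul_of_nonneg_right (by nlinarith) (by positivity)
    nlinarith

/-- Started from any point of a ball of squared radius `lam * ρ`, the walk spends a time of order
at least `ρ` in the ball of squared radius `ρ` before the time `ρ`. -/
lemma exists_occupation_lower_bound (hd : 1 ≤ d) : ∃ c lam ρ₀ : ℝ, 0 < c ∧ 1 < lam ∧
    ∀ ρ ≥ ρ₀, ∀ N : ℕ, ρ ≤ N → ∀ y : Site d, normSq y ≤ lam * ρ →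
      c * ρ ≤ ∑ j ∈ Finset.range N,
        (avg d ^ j) (fun x : Site d => if normSq x ≤ ρ then (1 : ℝ) else 0) y := by
  have hd0 : (1 : ℝ) ≤ d := by exact_mod_cast hd
  obtain ⟨a, ha⟩ : ∃ a : ℝ, a = 1 / (16 * (d : ℝ) ^ 2) := ⟨_, rfl⟩
  have ha0 : 0 < a := by rw [ha]; positivity
  have ha1 : a ≤ 1 / 16 := by
    rw [ha]
    refine one_div_le_one_div_of_le (by norm_num) ?_
    nlinarith
  have ha2 : a ^ 2 ≤ 1 / 256 := by nlinarith
  have ha4 : a ^ 4 ≤ 1 / 16 := by nlinarith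
  have ha6 : a ^ 6 ≤ 1 / 16 := by nlinarith [pow_pos ha0 4]
  -- The times used run from `a ^ 6 * ρ / 4` to `a ^ 6 * ρ`. For `a ^ 6 * ρ ≥ 8` at least `a ^ 6 * ρ
  -- / 2` of them survive rounding, each contributing `2 * a ^ 2`.
  refine ⟨a ^ 8, 1 + 3 / 4 * a ^ 4, 8 / a ^ 6, by positivity, by
    have := pow_pos ha0 4; linarith, fun ρ hρ N hN y hy => ?_⟩
  have hρ' : 8 ≤ a ^ 6 * ρ := by
    rw [ge_iff_le, div_le_iff₀ (by positivity)] at hρ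
    linarith
  have hρ0 : 0 < ρ := by
    rcases lt_or_ge 0 ρ with h | h
    · exact h
    · nlinarith [pow_pos ha0 6]
  obtain ⟨u, hu, huy⟩ := exists_unit_direction hd y
  set J0 := ⌈a ^ 6 * ρ / 4⌉₊ with hJ0
  set J1 := ⌊a ^ 6 * ρ⌋₊ with hJ1
  have hJ0' : (J0 : ℝ) < a ^ 6 * ρ / 4 + 1 := Nat.ceil_lt_add_one (by positivity)
  have hJ1' : a ^ 6 * ρ - 1 < J1 := Nat.sub_one_lt_floor _
  have hJ1'' : (J1 : ℝ) ≤ a ^ 6 * ρ := Nat.floor_le (by positivity)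
  have hJ : J0 ≤ J1 := by
    have : (J0 : ℝ) ≤ J1 := by linarith
    exact_mod_cast this
  have hsub : Finset.Ico J0 J1 ⊆ Finset.range N := by
    intro j hj
    rw [Finset.mem_Ico] at hj
    rw [Finset.mem_range]
    have : (J1 : ℝ) ≤ N := by nlinarith
    have : J1 ≤ N := by exact_mod_cast this
    omega
  have hnn : ∀ j, 0 ≤ (avg d ^ j) (fun x : Site d => if normSq x ≤ ρ then (1 : ℝ) else 0) y :=
    fun j => avg_pow_nonneg j (fun x => by simp only [Pi.zero_apply]; split_ifs <;> norm_num) y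
  have hterm : ∀ j ∈ Finset.Ico J0 J1,
      2 * a ^ 2 ≤ (avg d ^ j) (fun x : Site d => if normSq x ≤ ρ then (1 : ℝ) else 0) y := by
    intro j hj
    rw [Finset.mem_Ico] at hj
    have hj0 : a ^ 6 * ρ / 4 ≤ j := (Nat.le_ceil _).trans (by exact_mod_cast hj.1)
    have hj1 : (j : ℝ) ≤ a ^ 6 * ρ := le_trans (by exact_mod_cast hj.2.le) hJ1''
    have hj2 : 1 ≤ j := by
      have : (1 : ℝ) ≤ j := by linarith
      exact_mod_cast this
    refine (directed_move_prob hd hu ha hj2).trans ?_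
    have htr := congrFun (avg_pow_translate j (fun x : Site d => if normSq x ≤ ρ then (1 : ℝ) else 0)
      y) 0
    rw [add_zero] at htr
    rw [← htr]
    refine avg_pow_mono j (fun x => ?_) 0
    dsimp only
    split_ifs with h1 h2 h2
    · exact le_rfl
    · exfalso
      apply h2
      rw [huy]
      obtain ⟨hs, hQ⟩ := h1
      set R := Real.sqrt ρ with hR
      have hR0 : 0 < R := Real.sqrt_pos.2 hρ0
      have hRR : ρ = R ^ 2 := (Real.sq_sqrt hρ0.le).symm
      set r := Real.sqrt (normSq y) with hr
      have hr0 : 0 ≤ r := Real.sqrt_nonneg _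
      have hrr : normSq y = r ^ 2 := (Real.sq_sqrt (normSq_nonneg y)).symm
      set σ := Real.sqrt j with hσ
      have hσσ : (j : ℝ) = σ ^ 2 := (Real.sq_sqrt (by positivity)).symm
      have hσ0 : 0 ≤ σ := Real.sqrt_nonneg _
      rw [hrr, hRR] at hy
      rw [hRR, hσσ] at hj0 hj1
      rw [hrr, hRR]
      exact sq_radius_after_directed_move ha0 ha1 hR0 hr0 hσ0 hy hj0 hj1 hs hQ
    · norm_num
    · norm_num
  calc a ^ 8 * ρ ≤ (J1 - J0 : ℕ) • (2 * a ^ 2) := by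
        rw [nsmul_eq_mul, Nat.cast_sub hJ]
        have : a ^ 6 * ρ / 2 ≤ (J1 : ℝ) - J0 := by linarith
        nlinarith [sq_nonneg a]
    _ = ∑ j ∈ Finset.Ico J0 J1, 2 * a ^ 2 := by rw [Finset.sum_const, Nat.card_Ico]
    _ ≤ ∑ j ∈ Finset.Ico J0 J1, _ := Finset.sum_le_sum hterm
    _ ≤ _ := Finset.sum_le_sum_of_subset_of_nonneg hsub fun j _ _ => hnn j

end FrogModel

/-! ### Hitting and covering probabilities of a single walk -/

namespace FrogModel

variable {d : ℕ} {Ω : Type*} {x : Site d} {W : ℕ → Ω → Site d}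

lemma green_le (hd : 1 ≤ d) (N : ℕ) (z : Site d) : green N z ≤ N := by
  simp only [green, Finset.sum_apply]
  have h : ∀ j ∈ Finset.range N, (avg d ^ j) (Pi.single 0 1) z ≤ (1 : ℝ) := by
    intro j _
    have h1 : (Pi.single 0 1 : Site d → ℝ) ≤ fun _ => 1 := by
      intro w
      rw [Pi.single_apply]
      split_ifs <;> norm_num
    have := avg_pow_mono j h1 z
    rwa [avg_pow_const hd] at this
  simpa using Finset.sum_le_sum h

/-- The `n`-th step of a trajectory. -/
def walkStep (W : ℕ → Ω → Site d) (n : ℕ) (ω : Ω) : Site d := W (n + 1) ω - W n ω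

/-- The trajectory with the same steps as `W` that starts from `x` everywhere. -/
def rewalk (x : Site d) (W : ℕ → Ω → Site d) (n : ℕ) (ω : Ω) : Site d :=
  x + ∑ i ∈ Finset.range n, walkStep W i ω

lemma rewalk_zero (ω : Ω) : rewalk x W 0 ω = x := by simp [rewalk]

lemma rewalk_succ (n : ℕ) (ω : Ω) : rewalk x W (n + 1) ω = rewalk x W n ω + walkStep W n ω := by
  simp [rewalk, Finset.sum_range_succ, add_assoc]

/-- The `σ`-algebra generated by the first `n` steps. -/
@[reducible] def past (W : ℕ → Ω → Site d) (n : ℕ) : MeasurableSpace Ω :=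
  ⨆ i ∈ Set.Iio n, MeasurableSpace.comap (walkStep W i) inferInstance

lemma past_mono {m n : ℕ} (h : m ≤ n) : past W m ≤ past W n :=
  biSup_mono fun _ hi => lt_of_lt_of_le hi h

lemma measurable_walkStep_past {i n : ℕ} (h : i < n) : Measurable[past W n] (walkStep W i) :=
  Measurable.of_comap_le (le_biSup (fun i => MeasurableSpace.comap (walkStep W i) inferInstance)
    (show i ∈ Set.Iio n from h))

lemma measurable_rewalk_past {m n : ℕ} (h : m ≤ n) : Measurable[past W n] (rewalk x W m) := by
  let : MeasurableSpace Ω := past W n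
  unfold rewalk
  refine measurable_const.add (Finset.measurable_sum _ fun i hi => ?_)
  exact measurable_walkStep_past ((Finset.mem_range.1 hi).trans_le h)

lemma sum_abs_single (i : Fin d) : ∑ k, |(Pi.single i 1 : Site d) k| = 1 := by
  rw [Finset.sum_eq_single i] <;> simp +contextual

lemma sum_abs_neg_single (i : Fin d) : ∑ k, |(-Pi.single i 1 : Site d) k| = 1 := by
  simpa using sum_abs_single i

lemma single_ne_neg_single (i k : Fin d) : (Pi.single i 1 : Site d) ≠ -Pi.single k 1 := by
  intro h
  have := congrFun h i
  by_cases hik : i = k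
  · subst hik; simp at this
  · simp [hik] at this

/-- The event that `y` is not visited before time `n`. -/
def avoid (x : Site d) (W : ℕ → Ω → Site d) (y : Site d) (n : ℕ) : Set Ω :=
  {ω | ∀ j < n, rewalk x W j ω ≠ y}

lemma measurableSet_avoid_past (y : Site d) {m n : ℕ} (h : m ≤ n + 1) :
    MeasurableSet[past W n] (avoid x W y m) := by
  let : MeasurableSpace Ω := past W n
  have : avoid x W y m = ⋂ j ∈ Set.Iio m, (rewalk x W j ⁻¹' {y})ᶜ := by
    ext ω; simp [avoid]
  rw [this]
  refine MeasurableSet.biInter (Set.to_countable _) fun j hj => MeasurableSet.compl ?_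
  exact measurable_rewalk_past (by rw [Set.mem_Iio] at hj; omega) (measurableSet_singleton y)

variable [MeasurableSpace Ω] {P : Measure Ω}

namespace IsSimpleRandomWalk

lemma measurable_walkStep (h : IsSimpleRandomWalk P x W) (n : ℕ) : Measurable (walkStep W n) :=
  (h.measurable (n + 1)).sub (h.measurable n)

lemma past_le (h : IsSimpleRandomWalk P x W) (n : ℕ) :
    past W n ≤ (inferInstance : MeasurableSpace Ω) :=
  iSup₂_le fun i _ => (h.measurable_walkStep i).comap_le

lemma ae_eq_rewalk (h : IsSimpleRandomWalk P x W) : ∀ᵐ ω ∂P, ∀ n, W n ω = rewalk x W n ω := by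
  filter_upwards [h.start] with ω hω n
  induction n with
  | zero => rw [rewalk_zero, hω]
  | succ n ih => rw [rewalk_succ, ← ih, walkStep, add_sub_cancel]

lemma indep_past_walkStep (h : IsSimpleRandomWalk P x W) (n : ℕ) :
    Indep (past W n) (MeasurableSpace.comap (walkStep W n) inferInstance) P := by
  have h1 := indep_iSup_of_disjoint
    (m := fun i => MeasurableSpace.comap (walkStep W i) inferInstance)
    (μ := P) (fun i => (h.measurable_walkStep i).comap_le) h.indep_steps
    (S := Set.Iio n) (T := {n}) (by simp)
  simpa [past] using h1

lemma measurableSet_walkStep (h : IsSimpleRandomWalk P x W) (n : ℕ) (v : Site d) :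
    MeasurableSet (walkStep W n ⁻¹' {v}) :=
  h.measurable_walkStep n (measurableSet_singleton v)

lemma walkStep_law (h : IsSimpleRandomWalk P x W) (n : ℕ) {v : Site d} (hv : ∑ i, |v i| = 1) :
    P (walkStep W n ⁻¹' {v}) = (2 * (d : ENNReal))⁻¹ := h.step_law n v hv

/-- The `2 * d` disjoint events of a unit step already have total mass one. -/
lemma ae_walkStep [IsProbabilityMeasure P] (h : IsSimpleRandomWalk P x W) (hd : 1 ≤ d) (n : ℕ) :
    ∀ᵐ ω ∂P, ∃ i, walkStep W n ω = Pi.single i 1 ∨ walkStep W n ω = -Pi.single i 1 := by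
  have hm := h.measurableSet_walkStep n
  have hset : {ω | ∃ i, walkStep W n ω = Pi.single i 1 ∨ walkStep W n ω = -Pi.single i 1} =
      ⋃ i : Fin d, (walkStep W n ⁻¹' {(Pi.single i 1 : Site d)} ∪
        walkStep W n ⁻¹' {-(Pi.single i 1 : Site d)}) := by
    ext ω; simp
  have hmi : ∀ i : Fin d, MeasurableSet (walkStep W n ⁻¹' {(Pi.single i 1 : Site d)} ∪
      walkStep W n ⁻¹' {-(Pi.single i 1 : Site d)}) := fun i => (hm _).union (hm _)
  suffices P {ω | ∃ i, walkStep W n ω = Pi.single i 1 ∨ walkStep W n ω = -Pi.single i 1} = 1 by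
    rwa [← mem_ae_iff_prob_eq_one (by rw [hset]; exact MeasurableSet.iUnion hmi)] at this
  rw [hset, measure_iUnion ?_ hmi, tsum_fintype]
  · have : ∀ i : Fin d, P (walkStep W n ⁻¹' {(Pi.single i 1 : Site d)} ∪
        walkStep W n ⁻¹' {-(Pi.single i 1 : Site d)}) =
        2 * (2 * (d : ENNReal))⁻¹ := by
      intro i
      rw [measure_union ?_ (hm _), h.walkStep_law n (sum_abs_single i),
        h.walkStep_law n (sum_abs_neg_single i), ← two_mul]
      exact Disjoint.preimage _ (Set.disjoint_singleton.2 (single_ne_neg_single i i))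
    simp only [this, Finset.sum_const, Finset.card_univ, Fintype.card_fin, nsmul_eq_mul]
    rw [← mul_assoc, mul_comm (d : ENNReal)]
    refine ENNReal.mul_inv_cancel ?_ (by finiteness)
    have : (d : ENNReal) ≠ 0 := by positivity
    simp [this]
  · intro i k hik
    rw [Function.onFun, ← Set.preimage_union, ← Set.preimage_union]
    refine Disjoint.preimage _ ?_
    have h1 : (Pi.single i 1 : Site d) ≠ Pi.single k 1 := fun h => by
      have := congrFun h i
      simp [hik] at this
    simp only [Set.disjoint_union_left, Set.disjoint_union_right, Set.disjoint_singleton]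
    exact ⟨⟨h1, fun h => single_ne_neg_single k i h.symm⟩, single_ne_neg_single i k,
      fun h => h1 (neg_injective h)⟩

/-- The Markov property at a fixed time. -/
lemma setIntegral_rewalk_succ [IsProbabilityMeasure P] (h : IsSimpleRandomWalk P x W) (hd : 1 ≤ d)
    {n : ℕ} {E : Set Ω} (hE : MeasurableSet[past W n] E) {g : Site d → ℝ} {C : ℝ}
    (hg : ∀ z, |g z| ≤ C) :
    ∫ ω in E, g (rewalk x W (n + 1) ω) ∂P = ∫ ω in E, avg d g (rewalk x W n ω) ∂P := by
  have hE' : MeasurableSet E := h.past_le n _ hE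
  have hmeas : ∀ v : Site d, Measurable[past W n]
      (E.indicator fun ω => g (rewalk x W n ω + v)) := fun v => by
    let : MeasurableSpace Ω := past W n
    have h1 : Measurable fun z : Site d => g (z + v) := measurable_of_countable _
    exact (h1.comp (measurable_rewalk_past le_rfl)).indicator hE
  -- `T v` is the contribution of the step `v`: a factor determined by the past times the indicator
  -- of the step, so its integral factorizes.
  set T : Site d → Ω → ℝ := fun v ω => E.indicator (fun ω => g (rewalk x W n ω + v)) ω *
    (walkStep W n ⁻¹' {v}).indicator (fun _ => (1 : ℝ)) ω with hT
  have hprod : ∀ v : Site d, ∑ i, |v i| = 1 →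
      ∫ ω, T v ω ∂P =
      (2 * (d : ℝ))⁻¹ * ∫ ω in E, g (rewalk x W n ω + v) ∂P := by
    intro v hv
    have hind : IndepFun (E.indicator fun ω => g (rewalk x W n ω + v))
        ((walkStep W n ⁻¹' {v}).indicator (fun _ => (1 : ℝ))) P := by
      refine indep_of_indep_of_le_left (indep_of_indep_of_le_right (h.indep_past_walkStep n) ?_)
        (hmeas v).comap_le
      have : Measurable[MeasurableSpace.comap (walkStep W n) inferInstance]
          ((walkStep W n ⁻¹' {v}).indicator (fun _ => (1 : ℝ))) := by
        let : MeasurableSpace Ω := MeasurableSpace.comap (walkStep W n) inferInstance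
        exact measurable_const.indicator ⟨{v}, measurableSet_singleton v, rfl⟩
      exact this.comap_le
    rw [hT, hind.integral_fun_mul_eq_mul_integral
      ((hmeas v).mono (h.past_le n) le_rfl).aestronglyMeasurable
      (measurable_const.indicator (h.measurableSet_walkStep n v)).aestronglyMeasurable,
      integral_indicator hE', integral_indicator (h.measurableSet_walkStep n v), setIntegral_const,
      smul_eq_mul, mul_one, Measure.real, h.walkStep_law n hv, mul_comm]
    simp
  have hint : ∀ v : Site d, Integrable (T v) P := by
    intro v
    refine Integrable.of_bound (C := C)
      (((hmeas v).mono (h.past_le n) le_rfl).mul (measurable_const.indicator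
        (h.measurableSet_walkStep n v))).aestronglyMeasurable (Eventually.of_forall fun ω => ?_)
    have hC : 0 ≤ C := (abs_nonneg _).trans (hg 0)
    rw [Real.norm_eq_abs, abs_mul]
    simp only [Set.indicator]
    split_ifs <;> simp [hg, hC]
  have hint2 : ∀ v : Site d, IntegrableOn (fun ω => g (rewalk x W n ω + v)) E P := by
    intro v
    have h1 : Measurable fun z : Site d => g (z + v) := measurable_of_countable _
    exact Integrable.of_bound (C := C) ((h1.comp ((measurable_rewalk_past le_rfl).mono
      (h.past_le n) le_rfl)).aestronglyMeasurable) (Eventually.of_forall fun ω => hg _)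
  have hae : (E.indicator fun ω => g (rewalk x W (n + 1) ω)) =ᵐ[P] fun ω => ∑ i : Fin d,
      (T (Pi.single i 1) ω + T (-Pi.single i 1) ω) := by
    filter_upwards [h.ae_walkStep hd n] with ω hω
    simp only [hT]
    by_cases hωE : ω ∈ E
    · obtain ⟨k, hk⟩ := hω
      simp only [Set.indicator_of_mem hωE, rewalk_succ]
      rw [Finset.sum_eq_single k]
      · rcases hk with hk | hk
        · simp [Set.indicator, hk, single_ne_neg_single]
        · simp [Set.indicator, hk, (single_ne_neg_single _ _).symm]
      · intro i _ hik
        have h1 : (Pi.single i 1 : Site d) ≠ Pi.single k 1 := fun h => by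
          have := congrFun h i
          simp [hik] at this
        rcases hk with hk | hk
        · simp [Set.indicator, hk, single_ne_neg_single, h1.symm]
        · simp [Set.indicator, hk, (single_ne_neg_single _ _).symm, h1.symm]
      · simp
    · simp [hωE]
  rw [← integral_indicator hE', integral_congr_ae hae, integral_finsetSum _ fun i _ => ?_]
  swap
  · exact (hint _).add (hint _)
  simp only [avg_apply]
  rw [integral_const_mul, integral_finsetSum _ fun i _ => ?_, Finset.mul_sum]
  · refine Finset.sum_congr rfl fun i _ => ?_
    rw [integral_add (hint _) (hint _), hprod _ (sum_abs_single i), hprod _ (sum_abs_neg_single i)]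
    simp only [sub_eq_add_neg]
    rw [integral_add (hint2 _) (hint2 _), mul_add]
  · simp only [sub_eq_add_neg]
    exact (hint2 _).add (hint2 _)

/-- First-hit decomposition. If the walk is at `y` at time `n`, the hit is the first one and the
remaining visits number at most `green K 0` in mean; otherwise the Markov property moves to time `n
+ 1` with horizon `M - 1`. The differences of avoidance probabilities telescope, and a fixed `K ≥ M`
keeps the constant uniform. -/
lemma green_le_mul_avoid [IsProbabilityMeasure P] (h : IsSimpleRandomWalk P x W) (hd : 1 ≤ d)
    (y : Site d) {K : ℕ} : ∀ M n : ℕ, M ≤ K →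
    ∫ ω in avoid x W y n, green M (y - rewalk x W n ω) ∂P ≤
      (green K : Site d → ℝ) 0 * (P.real (avoid x W y n) - P.real (avoid x W y (n + M))) := by
  intro M
  induction M with
  | zero => intro n _; simp [green]
  | succ M ih =>
    intro n hM
    have hsub : avoid x W y (n + 1) ⊆ avoid x W y n := fun ω hω j hj => hω j (by omega)
    have hA : ∀ m, MeasurableSet (avoid x W y m) := fun m =>
      h.past_le m _ (measurableSet_avoid_past y (Nat.le_succ m))
    have hint : ∀ (f : Site d → ℝ) (C : ℝ), (∀ z, |f z| ≤ C) →
        ∀ A, IntegrableOn (fun ω => f (rewalk x W n ω)) A P := by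
      intro f C hf A
      exact Integrable.of_bound (C := C) (((measurable_of_countable f).comp
        ((measurable_rewalk_past le_rfl).mono (h.past_le n) le_rfl)).aestronglyMeasurable)
        (Eventually.of_forall fun ω => hf _)
    have hbd : ∀ (M : ℕ) (z : Site d), |green M (y - z)| ≤ (M : ℝ) := fun M z => by
      rw [abs_of_nonneg (green_nonneg M _)]
      exact green_le hd M _
    have h1 : ∫ ω in avoid x W y (n + 1), green (M + 1) (y - rewalk x W n ω) ∂P =
        ∫ ω in avoid x W y (n + 1), green M (y - rewalk x W (n + 1) ω) ∂P := by
      rw [h.setIntegral_rewalk_succ hd (g := fun z => green M (y - z))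
        (measurableSet_avoid_past y le_rfl) (hbd M), avg_reflect]
      refine setIntegral_congr_fun (hA _) fun ω hω => ?_
      have : y - rewalk x W n ω ≠ 0 := sub_ne_zero.2 (hω n (Nat.lt_succ_self n)).symm
      simp only [green_succ, Pi.add_apply, Pi.single_eq_of_ne this, zero_add]
    have h2 : ∫ ω in avoid x W y n \ avoid x W y (n + 1), green (M + 1) (y - rewalk x W n ω) ∂P ≤
        (green K : Site d → ℝ) 0 * (P.real (avoid x W y n) - P.real (avoid x W y (n + 1))) := by
      rw [← measureReal_sdiff hsub (hA _), mul_comm, ← smul_eq_mul, ← setIntegral_const]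
      refine setIntegral_mono_on (hint (fun z => green (M + 1) (y - z)) _ (hbd _) _)
        (integrableOn_const (by finiteness)) ((hA _).diff (hA _)) fun ω hω => ?_
      have : rewalk x W n ω = y := by
        by_contra hne
        refine hω.2 fun j hj => ?_
        rcases Nat.lt_succ_iff_lt_or_eq.1 hj with hj | rfl
        · exact hω.1 j hj
        · exact hne
      rw [this, sub_self]
      exact green_mono hM 0
    have h3 := ih (n + 1) (by omega)
    rw [← h1] at h3
    have h4 := setIntegral_union (μ := P) (f := fun ω => green (M + 1) (y - rewalk x W n ω))
      (s := avoid x W y (n + 1)) (t := avoid x W y n \ avoid x W y (n + 1))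
      Set.disjoint_sdiff_right ((hA _).diff (hA _))
      (hint (fun z => green (M + 1) (y - z)) _ (hbd _) _)
      (hint (fun z => green (M + 1) (y - z)) _ (hbd _) _)
    rw [Set.union_sdiff_cancel hsub] at h4
    rw [h4, show n + (M + 1) = n + 1 + M by ring]
    linarith

/-- The probability of hitting `y` before time `N` is at least the quotient of Green functions. -/
lemma green_le_mul_hit [IsProbabilityMeasure P] (h : IsSimpleRandomWalk P x W) (hd : 1 ≤ d)
    (y : Site d) (N : ℕ) :
    green N (y - x) ≤ (green N : Site d → ℝ) 0 * P.real {ω | ∃ j < N, W j ω = y} := by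
  have h1 := h.green_le_mul_avoid hd y (K := N) N 0 le_rfl
  have h0 : avoid x W y 0 = Set.univ := by ext; simp [avoid]
  simp only [h0, rewalk_zero, Measure.restrict_univ, integral_const, smul_eq_mul, zero_add,
    probReal_univ, one_mul] at h1
  have hA : MeasurableSet (avoid x W y N) :=
      h.past_le N _ (measurableSet_avoid_past y (Nat.le_succ N))
  rw [← probReal_compl_eq_one_sub hA] at h1
  have h2 : P.real (avoid x W y N)ᶜ = P.real {ω | ∃ j < N, W j ω = y} := by
    refine measureReal_congr ?_
    filter_upwards [h.ae_eq_rewalk] with ω hω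
    change (ω ∈ (avoid x W y N)ᶜ) = (ω ∈ {ω | ∃ j < N, W j ω = y})
    simp [avoid, hω]
  rwa [h2] at h1

/-- The displacements that the walk can make with positive probability, whatever its past. -/
def reachSet (P : Measure Ω) (x : Site d) (W : ℕ → Ω → Site d) : Set (Site d) :=
  {v | ∀ (n : ℕ) (E : Set Ω) (z : Site d), MeasurableSet[past W n] E →
      0 < P (E ∩ rewalk x W n ⁻¹' {z}) →
      ∃ m ≥ n, 0 < P (E ∩ rewalk x W m ⁻¹' {z + v})}

lemma step_mem_reachSet (h : IsSimpleRandomWalk P x W) {v : Site d} (hv : ∑ i, |v i| = 1) :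
    v ∈ reachSet P x W := by
  intro n E z hE hpos
  refine ⟨n + 1, Nat.le_succ n, ?_⟩
  have hEz : MeasurableSet[past W n] (E ∩ rewalk x W n ⁻¹' {z}) :=
    MeasurableSet.inter hE (measurable_rewalk_past le_rfl (measurableSet_singleton z))
  have hind := (Indep_iff _ _ _).1 (h.indep_past_walkStep n) _ (walkStep W n ⁻¹' {v}) hEz
    ⟨{v}, measurableSet_singleton v, rfl⟩
  rw [h.walkStep_law n hv] at hind
  have hpos' : 0 < P (E ∩ rewalk x W n ⁻¹' {z} ∩ walkStep W n ⁻¹' {v}) := by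
    rw [hind]
    exact ENNReal.mul_pos hpos.ne' (ENNReal.inv_ne_zero.2 (by finiteness))
  refine hpos'.trans_le (measure_mono ?_)
  rintro ω ⟨⟨h1, h2⟩, h3⟩
  refine ⟨h1, ?_⟩
  rw [Set.mem_preimage, Set.mem_singleton_iff] at h2 h3 ⊢
  rw [rewalk_succ, h2, h3]

lemma zero_mem_reachSet : (0 : Site d) ∈ reachSet P x W :=
  fun n E z _ hpos => ⟨n, le_rfl, by rwa [add_zero]⟩

/-- Quantifying over every past event and endpoint in `reachSet` makes it closed under addition: the
same event is still past at the later time. -/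
lemma add_mem_reachSet {v w : Site d} (hv : v ∈ reachSet P x W) (hw : w ∈ reachSet P x W) :
    v + w ∈ reachSet P x W := by
  intro n E z hE hpos
  obtain ⟨m, hm, hpos⟩ := hv n E z hE hpos
  obtain ⟨k, hk, hpos⟩ := hw m E _ (past_mono hm _ hE) hpos
  exact ⟨k, le_trans hm hk, by rwa [← add_assoc]⟩

lemma mem_reachSet (h : IsSimpleRandomWalk P x W) (v : Site d) : v ∈ reachSet P x W := by
  have hsingle : ∀ (i : Fin d) (k : ℤ), (Pi.single i k : Site d) ∈ reachSet P x W := by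
    intro i k
    induction k using Int.induction_on with
    | zero => rw [Pi.single_zero]; exact zero_mem_reachSet
    | succ k ih =>
      rw [Pi.single_add]
      exact add_mem_reachSet ih (h.step_mem_reachSet (sum_abs_single i))
    | pred k ih =>
      have hneg : (Pi.single i (-1) : Site d) = -Pi.single i 1 := by
        ext j
        by_cases hj : j = i
        · subst hj; simp
        · simp [hj]
      rw [sub_eq_add_neg, Pi.single_add, hneg]
      exact add_mem_reachSet ih (h.step_mem_reachSet (sum_abs_neg_single i))
  have hsum : ∀ s : Finset (Fin d), ∑ i ∈ s, (Pi.single i (v i) : Site d) ∈ reachSet P x W := by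
    intro s
    induction s using Finset.induction_on with
    | empty => exact zero_mem_reachSet
    | insert i s his ih =>
      rw [Finset.sum_insert his]
      exact add_mem_reachSet (hsingle _ _) ih
  have := hsum Finset.univ
  rwa [Finset.univ_sum_single] at this

/-- Every finite set is covered in bounded time with positive probability. -/
lemma exists_cover_pos [IsProbabilityMeasure P] (h : IsSimpleRandomWalk P x W)
    (B : Finset (Site d)) :
    ∃ N : ℕ, 0 < P {ω | ∀ b ∈ B, ∃ j < N, W j ω = b} := by
  -- The induction carries a past event and a fixed endpoint, so that a path to the next site can be
  -- appended.
  suffices ∃ (n : ℕ) (E : Set Ω) (z : Site d), MeasurableSet[past W n] E ∧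
      (∀ ω ∈ E, ∀ b ∈ B, ∃ j ≤ n, rewalk x W j ω = b) ∧
      0 < P (E ∩ rewalk x W n ⁻¹' {z}) by
    obtain ⟨n, E, z, -, hE, hpos⟩ := this
    refine ⟨n + 1, hpos.trans_le (measure_mono_ae ?_)⟩
    filter_upwards [h.ae_eq_rewalk] with ω hω hωE b hb
    obtain ⟨j, hj, hjb⟩ := hE ω hωE.1 b hb
    exact ⟨j, by omega, by rw [hω, hjb]⟩
  induction B using Finset.induction_on with
  | empty =>
    refine ⟨0, Set.univ, x, MeasurableSet.univ, by simp, ?_⟩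
    have : rewalk x W 0 ⁻¹' {x} = Set.univ := by ext; simp [rewalk_zero]
    simp [this]
  | insert b B _ ih =>
    obtain ⟨n, E, z, hEm, hE, hpos⟩ := ih
    obtain ⟨m, hm, hpos⟩ := h.mem_reachSet (b - z) n E z hEm hpos
    rw [add_sub_cancel] at hpos
    refine ⟨m, E ∩ rewalk x W m ⁻¹' {b}, b, ?_, ?_, ?_⟩
    · exact MeasurableSet.inter (past_mono hm _ hEm)
        (measurable_rewalk_past le_rfl (measurableSet_singleton b))
    · rintro ω ⟨hωE, hωb⟩ c hc
      rcases Finset.mem_insert.1 hc with rfl | hc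
      · exact ⟨m, le_rfl, hωb⟩
      · obtain ⟨j, hj, hjc⟩ := hE ω hωE c hc
        exact ⟨j, hj.trans hm, hjc⟩
    · rwa [Set.inter_assoc, Set.inter_self]

end IsSimpleRandomWalk
end FrogModel

/-! ### Deterministic facts about activation times -/

namespace FrogModel

variable {d : ℕ} {L : Site d → ℕ} {w : Site d → ℕ → Site d}

/-- The particle from `x` visits `y` within its lifetime. -/
def Hits (L : Site d → ℕ) (w : Site d → ℕ → Site d) (x y : Site d) : Prop :=
  ∃ n < L x, w x n = y

/-- The trajectories are nearest-neighbour paths starting from their labels. -/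
structure IsNearestNeighbour (w : Site d → ℕ → Site d) : Prop where
  start : ∀ x, w x 0 = x
  step : ∀ x n, ∃ i, w x (n + 1) = w x n + Pi.single i 1 ∨ w x (n + 1) = w x n - Pi.single i 1

lemma IsNearestNeighbour.natAbs_step_le (hw : IsNearestNeighbour w) (x : Site d) (n : ℕ)
    (i : Fin d) : (w x (n + 1) i - w x n i).natAbs ≤ 1 := by
  obtain ⟨k, hk | hk⟩ := hw.step x n <;> rw [hk] <;> by_cases hik : i = k
  · subst hik; simp
  · simp [hik]
  · subst hik; simp
  · simp [hik]

lemma IsNearestNeighbour.natAbs_sub_le (hw : IsNearestNeighbour w) (x : Site d) (n : ℕ)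
    (i : Fin d) : (w x n i - x i).natAbs ≤ n := by
  induction n with
  | zero => simp [hw.start]
  | succ n ih =>
    have := hw.natAbs_step_le x n i
    omega

lemma activationTime_zero : activationTime L w 0 = 0 :=
  le_antisymm (iInf_le_of_le 0 (iInf_le_of_le (fun _ => 0) (iInf_le_of_le ⟨rfl, rfl⟩ (by simp))))
    bot_le

lemma activationTime_le_add (x y : Site d) :
    activationTime L w y ≤ activationTime L w x + passageTime L w x y := by
  conv_rhs => rw [activationTime]
  rw [ENat.iInf_add]
  refine le_iInf fun m => ?_
  rw [ENat.iInf_add]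
  refine le_iInf fun p => ?_
  rw [ENat.iInf_add]
  refine le_iInf fun hp => ?_
  refine iInf_le_of_le (m + 1) (iInf_le_of_le (fun i => if i ≤ m then p i else y)
    (iInf_le_of_le ⟨by simp [hp.1], by simp⟩ ?_))
  rw [Finset.sum_range_succ]
  refine add_le_add (Finset.sum_le_sum fun i hi => ?_) ?_
  · rw [Finset.mem_range] at hi
    simp [hi.le, Nat.succ_le_of_lt hi]
  · simp [hp.2]

lemma activationTime_ne_top_of_hits {x y : Site d} (hx : activationTime L w x ≠ ⊤)
    (h : Hits L w x y) : activationTime L w y ≠ ⊤ := by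
  obtain ⟨n, hn, hny⟩ := h
  have h1 : passageTime L w x y ≤ n := iInf_le_of_le n (iInf_le_of_le ⟨hn, hny⟩ le_rfl)
  refine ne_top_of_le_ne_top ?_ (activationTime_le_add x y)
  exact WithTop.add_ne_top.2 ⟨hx, ne_top_of_le_ne_top (ENat.natCast_ne_top n) h1⟩

/-- A particle changes each coordinate by at most one per time unit, so the passage times along a
chain dominate its displacement. -/
lemma natAbs_le_activationTime (hw : IsNearestNeighbour w) (x : Site d) (i : Fin d) :
    ((x i).natAbs : ℕ∞) ≤ activationTime L w x := by
  refine le_iInf fun m => le_iInf fun p => le_iInf fun hp => ?_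
  have h : ∀ k, ((p k i - p 0 i).natAbs : ℕ∞) ≤
      ∑ j ∈ Finset.range k, passageTime L w (p j) (p (j + 1)) := by
    intro k
    induction k with
    | zero => simp
    | succ k ih =>
      rw [Finset.sum_range_succ]
      have h1 : ((p (k + 1) i - p k i).natAbs : ℕ∞) ≤ passageTime L w (p k) (p (k + 1)) := by
        refine le_iInf fun n => le_iInf fun hn => ?_
        rw [← hn.2]
        exact_mod_cast hw.natAbs_sub_le (p k) n i
      refine le_trans ?_ (add_le_add ih h1)
      have : (p (k + 1) i - p 0 i).natAbs ≤ (p k i - p 0 i).natAbs + (p (k + 1) i - p k i).natAbs := by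
        omega
      exact_mod_cast this
  have := h m
  rw [hp.1, hp.2] at this
  simpa using this

/-- Several particles may visit the origin at the same time, so infinitely many visitors do not
suffice by themselves. But if visit times were at most `M`, each visitor would be activated by time
`M` and hence start in a fixed box, leaving only finitely many visitors. -/
lemma visitTimes_infinite (hw : IsNearestNeighbour w) (hact : ∀ x, activationTime L w x ≠ ⊤)
    (hhit : ∀ D : Finset (Site d), ∃ x ∉ D, Hits L w x 0) : (visitTimes L w).Infinite := by
  intro hfin
  obtain ⟨M, hM⟩ := hfin.bddAbove
  have hsub : {x : Site d | Hits L w x 0} ⊆ Set.Icc (fun _ => -(M : ℤ)) (fun _ => (M : ℤ)) := by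
    rintro x ⟨n, hn, hn0⟩
    obtain ⟨a, ha⟩ := ENat.ne_top_iff_exists.1 (hact x)
    have hmem : a + n ∈ visitTimes L w := ⟨x, n, hn, hn0, by rw [← ha]; push_cast; rfl⟩
    have h1 : a + n ≤ M := hM hmem
    have h2 : ∀ i, (x i).natAbs ≤ a := fun i => by
      have := natAbs_le_activationTime (L := L) hw x i
      rw [← ha] at this
      exact_mod_cast this
    constructor <;> intro i <;> have := h2 i <;> simp only <;> omega
  have hfin' : {x : Site d | Hits L w x 0}.Finite := (Set.finite_Icc _ _).subset hsub
  obtain ⟨x, hx, hx0⟩ := hhit hfin'.toFinset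
  exact hx (by simpa using hx0)

end FrogModel

/-! ### Independence of the particles and a criterion for recurrence -/

namespace FrogModel

variable {d : ℕ} {Ω : Type*}

/-- The lifetime and the trajectory of the particle from `x`. -/
def particle (Ξ : Site d → Ω → ℕ) (S : Site d → ℕ → Ω → Site d) (x : Site d) (ω : Ω) :
    ℕ × (ℕ → Site d) :=
  (Ξ x ω, fun n => S x n ω)

/-- The lives of length at least `N` that visit `y` before time `N`. -/
def hitSet (N : ℕ) (y : Site d) : Set (ℕ × (ℕ → Site d)) :=
  {k | N ≤ k} ×ˢ {p | ∃ j < N, p j = y}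

lemma measurableSet_visit (N : ℕ) (y : Site d) :
    MeasurableSet {p : ℕ → Site d | ∃ j < N, p j = y} := by
  have : {p : ℕ → Site d | ∃ j < N, p j = y} = ⋃ j ∈ Set.Iio N, (fun p => p j) ⁻¹' {y} := by
    ext; simp
  rw [this]
  exact MeasurableSet.biUnion (Set.to_countable _) fun j _ =>
    measurable_pi_apply j (measurableSet_singleton y)

lemma measurableSet_hitSet (N : ℕ) (y : Site d) : MeasurableSet (hitSet N y) :=
  (MeasurableSet.of_discrete).prod (measurableSet_visit N y)

/-- The event that no particle from `B` visits `y` before time `N` within a lifetime `≥ N`. -/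
def missEvent (Ξ : Site d → Ω → ℕ) (S : Site d → ℕ → Ω → Site d) (N : ℕ) (B : Finset (Site d))
    (y : Site d) : Set Ω :=
  ⋂ x ∈ B, particle Ξ S x ⁻¹' (hitSet N y)ᶜ

lemma hits_of_notMem_missEvent {Ξ : Site d → Ω → ℕ} {S : Site d → ℕ → Ω → Site d} {N : ℕ}
    {B : Finset (Site d)} {y : Site d} {ω : Ω} (h : ω ∉ missEvent Ξ S N B y) :
    ∃ x ∈ B, Hits (fun x => Ξ x ω) (fun x n => S x n ω) x y := by
  simp only [missEvent, Set.mem_iInter, not_forall] at h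
  obtain ⟨x, hx, hxh⟩ := h
  simp only [Set.preimage_compl, Set.mem_compl_iff, not_not] at hxh
  obtain ⟨h1, j, hj, hjy⟩ := hxh
  exact ⟨x, hx, j, lt_of_lt_of_le hj h1, hjy⟩

variable [MeasurableSpace Ω] {P : Measure Ω} {ν : Measure ℕ} {Ξ : Site d → Ω → ℕ}
  {S : Site d → ℕ → Ω → Site d}

namespace IsInput

lemma measurable_path (h : IsInput P ν Ξ S) (x : Site d) : Measurable fun ω n => S x n ω :=
  measurable_pi_lambda _ fun n => (h.walk x).measurable n

lemma measurable_particle (h : IsInput P ν Ξ S) (x : Site d) : Measurable (particle Ξ S x) :=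
  (h.lifetime_measurable x).prodMk (h.measurable_path x)

lemma indepFun_lifetime_path (h : IsInput P ν Ξ S) (x : Site d) :
    IndepFun (Ξ x) (fun ω n => S x n ω) P :=
  h.lifetime_indep_walk.comp (φ := fun ξ : Site d → ℕ => ξ x)
    (ψ := fun s : Site d → ℕ → Site d => s x) (measurable_pi_apply x) (measurable_pi_apply x)

lemma measure_particle_prod (h : IsInput P ν Ξ S) (x : Site d) {A : Set ℕ}
    {B : Set (ℕ → Site d)} (hB : MeasurableSet B) :
    P (particle Ξ S x ⁻¹' (A ×ˢ B)) = ν A * P ((fun ω n => S x n ω) ⁻¹' B) := by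
  have h1 := (h.indepFun_lifetime_path x).measure_inter_preimage_eq_mul A B
    MeasurableSet.of_discrete hB
  rw [← h.lifetime_law x, Measure.map_apply (h.lifetime_measurable x) MeasurableSet.of_discrete,
    ← h1]
  rfl

/-- On the π-system of rectangles, an intersection splits into a lifetime event and a trajectory
event; each of the three independence assumptions then factorizes once. -/
lemma iIndepFun_particle (h : IsInput P ν Ξ S) : iIndepFun (particle Ξ S) P := by
  have : IsProbabilityMeasure P := h.lifetime_indep.isProbabilityMeasure
  refine iIndepSets.iIndep
    (m := fun x => MeasurableSpace.comap (particle Ξ S x) inferInstance)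
    (fun x => (h.measurable_particle x).comap_le)
    (fun x => Set.preimage (particle Ξ S x) ''
      (Set.image2 (· ×ˢ ·) {A : Set ℕ | MeasurableSet A} {B : Set (ℕ → Site d) | MeasurableSet B}))
    (fun x => ?_) (fun x => ?_) ?_
  · exact isPiSystem_prod.comap _
  · rw [← MeasurableSpace.comap_generateFrom, generateFrom_prod]
  · rw [iIndepSets_iff]
    intro s f hf
    have hAB : ∀ x, ∃ (A : Set ℕ) (B : Set (ℕ → Site d)), MeasurableSet B ∧
        (x ∈ s → f x = particle Ξ S x ⁻¹' (A ×ˢ B)) := by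
      intro x
      by_cases hx : x ∈ s
      · obtain ⟨_, ⟨A, -, B, hB, rfl⟩, hfx⟩ := hf x hx
        exact ⟨A, B, hB, fun _ => hfx.symm⟩
      · exact ⟨∅, ∅, MeasurableSet.empty, fun h => absurd h hx⟩
    choose A B hB hAB using hAB
    have h1 : (⋂ x ∈ s, f x) =
        ((fun ω x => Ξ x ω) ⁻¹' {ξ | ∀ x ∈ s, ξ x ∈ A x}) ∩
        ((fun ω x n => S x n ω) ⁻¹' {p | ∀ x ∈ s, p x ∈ B x}) := by
      ext ω
      simp only [Set.mem_iInter, Set.mem_inter_iff, Set.mem_preimage, Set.mem_ofPred_eq]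
      rw [← forall₂_and]
      refine forall₂_congr fun x hx => ?_
      rw [hAB x hx]
      rfl
    have hmA : MeasurableSet {ξ : Site d → ℕ | ∀ x ∈ s, ξ x ∈ A x} := by
      have : {ξ : Site d → ℕ | ∀ x ∈ s, ξ x ∈ A x} = ⋂ x ∈ s, (fun ξ => ξ x) ⁻¹' A x := by
        ext; simp
      rw [this]
      exact Finset.measurableSet_biInter _ fun x _ =>
        measurable_pi_apply x MeasurableSet.of_discrete
    have hmB : MeasurableSet {p : Site d → ℕ → Site d | ∀ x ∈ s, p x ∈ B x} := by
      have : {p : Site d → ℕ → Site d | ∀ x ∈ s, p x ∈ B x} =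
          ⋂ x ∈ s, (fun p => p x) ⁻¹' B x := by
        ext; simp
      rw [this]
      exact Finset.measurableSet_biInter _ fun x _ => measurable_pi_apply x (hB x)
    rw [h1, h.lifetime_indep_walk.measure_inter_preimage_eq_mul _ _ hmA hmB]
    have h2 : (fun ω x => Ξ x ω) ⁻¹' {ξ : Site d → ℕ | ∀ x ∈ s, ξ x ∈ A x} =
        ⋂ x ∈ s, Ξ x ⁻¹' A x := by ext; simp
    have h3 : (fun ω x n => S x n ω) ⁻¹' {p : Site d → ℕ → Site d | ∀ x ∈ s, p x ∈ B x} =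
        ⋂ x ∈ s, (fun ω n => S x n ω) ⁻¹' B x := by ext; simp
    rw [h2, h3, h.lifetime_indep.meas_biInter fun x _ => ⟨A x, MeasurableSet.of_discrete, rfl⟩,
      h.walk_indep.meas_biInter fun x _ => ⟨B x, hB x, rfl⟩, ← Finset.prod_mul_distrib]
    refine Finset.prod_congr rfl fun x hx => ?_
    rw [hAB x hx, h.measure_particle_prod x (hB x), ← h.lifetime_law x,
      Measure.map_apply (h.lifetime_measurable x) MeasurableSet.of_discrete]

/-- Independence and `1 - q ≤ exp (-q)` reduce this to the sum of the hitting probabilities.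
Removing `D` lowers that sum by at most `D.card`, whence a factor that does not depend on the scale.
-/
lemma real_missEvent_le [IsProbabilityMeasure P] [IsProbabilityMeasure ν] (h : IsInput P ν Ξ S)
    (hd : 1 ≤ d) {N : ℕ} (hN : 1 ≤ N) (B D : Finset (Site d)) (y : Site d) :
    P.real (missEvent Ξ S N (B \ D) y) ≤ Real.exp D.card *
      Real.exp (-(ν.real {k | N ≤ k} / (green N : Site d → ℝ) 0 * ∑ x ∈ B, green N (y - x))) := by
  have hG : 0 < (green N : Site d → ℝ) 0 := zero_lt_one.trans_le (one_le_green_zero hN)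
  set q : Site d → ℝ := fun x => P.real (particle Ξ S x ⁻¹' hitSet N y) with hq
  have hq1 : ∀ x, q x ≤ 1 := fun x => measureReal_le_one
  have hq0 : ∀ x, 0 ≤ q x := fun x => measureReal_nonneg
  have hqG : ∀ x, ν.real {k | N ≤ k} / (green N : Site d → ℝ) 0 * green N (y - x) ≤ q x := by
    intro x
    have h1 := (h.walk x).green_le_mul_hit hd y N
    have h2 : q x = ν.real {k | N ≤ k} * P.real {ω | ∃ j < N, S x j ω = y} := by
      simp only [hq, hitSet, Measure.real, h.measure_particle_prod x (measurableSet_visit N y),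
        ENNReal.toReal_mul]
      rfl
    rw [h2, div_mul_eq_mul_div, mul_div_assoc]
    refine mul_le_mul_of_nonneg_left ?_ measureReal_nonneg
    rwa [div_le_iff₀ hG, mul_comm]
  have hprod : P.real (missEvent Ξ S N (B \ D) y) = ∏ x ∈ B \ D, (1 - q x) := by
    rw [missEvent, Measure.real, h.iIndepFun_particle.meas_biInter fun x _ =>
      ⟨_, (measurableSet_hitSet N y).compl, rfl⟩, ENNReal.toReal_prod]
    refine Finset.prod_congr rfl fun x _ => ?_
    rw [Set.preimage_compl]
    exact probReal_compl_eq_one_sub (h.measurable_particle x (measurableSet_hitSet N y))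
  rw [hprod]
  calc ∏ x ∈ B \ D, (1 - q x) ≤ ∏ x ∈ B \ D, Real.exp (-q x) :=
        Finset.prod_le_prod (fun x _ => by linarith [hq1 x]) fun x _ => by
          linarith [Real.add_one_le_exp (-q x)]
    _ = Real.exp (-∑ x ∈ B \ D, q x) := by rw [← Real.exp_sum, Finset.sum_neg_distrib]
    _ ≤ _ := by
        rw [← Real.exp_add, Real.exp_le_exp]
        have h1 : ∑ x ∈ B, q x ≤ ∑ x ∈ B \ D, q x + D.card := by
          have h2 : ∑ x ∈ B, q x ≤ ∑ x ∈ B \ D ∪ D, q x :=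
            Finset.sum_le_sum_of_subset_of_nonneg (by simp) fun x _ _ => hq0 x
          have h3 : ∑ x ∈ B \ D ∪ D, q x = ∑ x ∈ B \ D, q x + ∑ x ∈ D, q x :=
            Finset.sum_union Finset.sdiff_disjoint
          have h4 : ∑ x ∈ D, q x ≤ D.card := by
            simpa using Finset.sum_le_sum fun x (_ : x ∈ D) => hq1 x
          linarith
        have h5 : ν.real {k | N ≤ k} / (green N : Site d → ℝ) 0 * ∑ x ∈ B, green N (y - x) ≤
            ∑ x ∈ B, q x := by
          rw [Finset.mul_sum]
          exact Finset.sum_le_sum fun x _ => hqG x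
        linarith

lemma ae_isNearestNeighbour [IsProbabilityMeasure P] (h : IsInput P ν Ξ S) (hd : 1 ≤ d) :
    ∀ᵐ ω ∂P, IsNearestNeighbour fun x n => S x n ω := by
  have h1 : ∀ᵐ ω ∂P, ∀ x, S x 0 ω = x := ae_all_iff.2 fun x => (h.walk x).start
  have h2 : ∀ᵐ ω ∂P, ∀ x n, ∃ i, walkStep (S x) n ω = Pi.single i 1 ∨
      walkStep (S x) n ω = -Pi.single i 1 :=
    ae_all_iff.2 fun x => ae_all_iff.2 fun n => (h.walk x).ae_walkStep hd n
  filter_upwards [h1, h2] with ω hω1 hω2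
  refine ⟨hω1, fun x n => ?_⟩
  obtain ⟨i, hi⟩ := hω2 x n
  refine ⟨i, hi.imp (fun hi => ?_) fun hi => ?_⟩
  · rw [← hi, walkStep, add_sub_cancel]
  · rw [sub_eq_add_neg, ← hi, walkStep, add_sub_cancel]

/-- A criterion for recurrence in terms of a sequence of finite sets `B k` exhausting the lattice
such that, if all particles of `B k` are active, the sites of `T k` are hit, except with a summable
probability, and then the whole of `B (k + 1)` is covered. -/
theorem isRecurrent_of_summable [IsProbabilityMeasure P] [IsProbabilityMeasure ν]
    (h : IsInput P ν Ξ S) (hd : 1 ≤ d) (hν : ∀ N : ℕ, 0 < ν {k | N ≤ k})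
    {B T : ℕ → Finset (Site d)} {N : ℕ → ℕ} {b : ℕ → ℝ} (hN : ∀ k, 1 ≤ N k)
    (hB : ∀ x, ∃ k₀, ∀ k ≥ k₀, x ∈ B k) (hT : ∀ k, 0 ∈ T k)
    (hcover : ∀ (L : Site d → ℕ) (w : Site d → ℕ → Site d), IsNearestNeighbour w →
      ∀ k, (∀ y ∈ T k, ∃ x ∈ B k, Hits L w x y) →
        ∀ y ∈ B (k + 1), y ∈ B k ∨ ∃ x ∈ B k, Hits L w x y)
    (hsum : Summable b)
    (hb : ∀ᶠ k in atTop, ∀ y ∈ T k, (T k).card * Real.exp (-(ν.real {n | N k ≤ n} /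
      (green (N k) : Site d → ℝ) 0 * ∑ x ∈ B k, green (N k) (y - x))) ≤ b k) :
    IsRecurrent P Ξ S := by
  classical
  set F : Finset (Site d) → ℕ → Set Ω := fun D k =>
    ⋃ y ∈ T k, missEvent Ξ S (N k) (B k \ D) y with hF
  obtain ⟨K₁, hK₁⟩ := eventually_atTop.1 hb
  have hFle : ∀ D, ∀ k ≥ K₁, P (F D k) ≤ ENNReal.ofReal (Real.exp D.card * b k) := by
    intro D k hk
    rw [← ofReal_measureReal (measure_ne_top P _)]
    refine ENNReal.ofReal_le_ofReal ?_
    have hTpos : (0 : ℝ) < (T k).card := by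
      exact_mod_cast Finset.card_pos.2 ⟨0, hT k⟩
    calc P.real (F D k) ≤ ∑ y ∈ T k, P.real (missEvent Ξ S (N k) (B k \ D) y) :=
          measureReal_biUnion_finset_le _ _
      _ ≤ ∑ y ∈ T k, Real.exp D.card * (b k / (T k).card) := by
          refine Finset.sum_le_sum fun y hy => (h.real_missEvent_le hd (hN k) _ _ _).trans ?_
          refine mul_le_mul_of_nonneg_left ?_ (Real.exp_pos _).le
          rw [le_div_iff₀ hTpos, mul_comm]
          exact hK₁ k hk y hy
      _ = _ := by
          rw [Finset.sum_const, nsmul_eq_mul]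
          field_simp
  have hmF : ∀ (D : Finset (Site d)) k, MeasurableSet[⨆ x ∈ {x | x ∉ D},
      MeasurableSpace.comap (particle Ξ S x) inferInstance] (F D k) := by
    intro D k
    refine Finset.measurableSet_biUnion _ fun y _ => Finset.measurableSet_biInter _ fun x hx => ?_
    refine (le_biSup (fun x => MeasurableSpace.comap (particle Ξ S x) inferInstance)
      (show x ∈ {x | x ∉ D} from (Finset.mem_sdiff.1 hx).2)) _ ?_
    exact ⟨_, (measurableSet_hitSet _ y).compl, rfl⟩
  have hle : ∀ D : Finset (Site d), (⨆ x ∈ {x | x ∉ D},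
      MeasurableSpace.comap (particle Ξ S x) inferInstance) ≤ ‹MeasurableSpace Ω› :=
    fun D => iSup₂_le fun x _ => (h.measurable_particle x).comap_le
  have hbnn : ∀ k ≥ K₁, 0 ≤ b k := fun k hk =>
    le_trans (by positivity) (hK₁ k hk 0 (hT k))
  -- almost surely, each finite set of particles can eventually be dispensed with
  have hae : ∀ᵐ ω ∂P, ∀ D : Finset (Site d), ∀ᶠ k in atTop, ω ∉ F D k := by
    rw [ae_all_iff]
    intro D
    have hfin : ∑' k, P (F D (k + K₁)) ≠ ⊤ := by
      have hs : Summable fun k => Real.exp D.card * b (k + K₁) :=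
        ((summable_nat_add_iff K₁).2 hsum).mul_left _
      refine ne_top_of_le_ne_top hs.tsum_ofReal_ne_top (ENNReal.tsum_le_tsum fun k => ?_)
      exact hFle D _ (Nat.le_add_left _ _)
    filter_upwards [ae_eventually_notMem hfin] with ω hω
    obtain ⟨k₀, hk₀⟩ := eventually_atTop.1 hω
    filter_upwards [eventually_ge_atTop (k₀ + K₁)] with k hk
    have := hk₀ (k - K₁) (by omega)
    rwa [Nat.sub_add_cancel (by omega)] at this
  -- with positive probability, the particles outside the origin never fail after some scale
  obtain ⟨K, hK, hKpos⟩ : ∃ K ≥ K₁, 0 < P (⋂ k, (F {0} (k + K))ᶜ) := by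
    have hs : Summable fun k => Real.exp ({0} : Finset (Site d)).card * b k := hsum.mul_left _
    have htend := tendsto_sum_nat_add fun k => Real.exp ({0} : Finset (Site d)).card * b k
    obtain ⟨K, hK1, hK⟩ := ((htend.eventually_lt_const (zero_lt_one)).and
      (eventually_ge_atTop K₁)).exists
    refine ⟨K, hK, ?_⟩
    have hlt : P (⋃ k, F {0} (k + K)) < 1 := by
      calc P (⋃ k, F {0} (k + K)) ≤ ∑' k, P (F {0} (k + K)) := measure_iUnion_le _
        _ ≤ ∑' k, ENNReal.ofReal (Real.exp ({0} : Finset (Site d)).card * b (k + K)) :=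
            ENNReal.tsum_le_tsum fun k => hFle _ _ (hK.trans (Nat.le_add_left _ _))
        _ = ENNReal.ofReal (∑' k, Real.exp ({0} : Finset (Site d)).card * b (k + K)) :=
            (ENNReal.ofReal_tsum_of_nonneg (fun k => mul_nonneg (Real.exp_pos _).le
              (hbnn _ (hK.trans (Nat.le_add_left _ _)))) ((summable_nat_add_iff K).2 hs)).symm
        _ < 1 := by rwa [ENNReal.ofReal_lt_one]
    rw [← Set.compl_iUnion, prob_compl_eq_one_sub
      (MeasurableSet.iUnion fun k => hle _ _ (hmF _ _))]
    exact tsub_pos_of_lt hlt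
  -- the particle from the origin covers `B K`
  obtain ⟨M, hM⟩ := (h.walk 0).exists_cover_pos (B K)
  set C : Set (ℕ × (ℕ → Site d)) := {k | M ≤ k} ×ˢ {p | ∀ y ∈ B K, ∃ j < M, p j = y} with hC
  have hmC' : MeasurableSet {p : ℕ → Site d | ∀ y ∈ B K, ∃ j < M, p j = y} := by
    have : {p : ℕ → Site d | ∀ y ∈ B K, ∃ j < M, p j = y} =
        ⋂ y ∈ B K, {p : ℕ → Site d | ∃ j < M, p j = y} := by ext; simp
    rw [this]
    exact Finset.measurableSet_biInter _ fun y _ => measurableSet_visit M y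
  have hCpos : 0 < P (particle Ξ S 0 ⁻¹' C) := by
    rw [hC, h.measure_particle_prod 0 hmC']
    exact ENNReal.mul_pos (hν M).ne' hM.ne'
  -- The events `F {0} k` do not involve the origin's particle, so they are independent of its
  -- covering `B K`.
  have hind := indep_iSup_of_disjoint
    (m := fun x => MeasurableSpace.comap (particle Ξ S x) inferInstance)
    (fun x => (h.measurable_particle x).comap_le) h.iIndepFun_particle
    (S := {0}) (T := {x | x ∉ ({0} : Finset (Site d))}) (by simp)
  have hpos : 0 < P (particle Ξ S 0 ⁻¹' C ∩ ⋂ k, (F {0} (k + K))ᶜ) := by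
    rw [(Indep_iff _ _ _).1 hind _ _ ?_ ?_]
    · exact ENNReal.mul_pos hCpos.ne' hKpos.ne'
    · refine (le_biSup (fun x => MeasurableSpace.comap (particle Ξ S x) inferInstance)
        (Set.mem_singleton 0)) _ ?_
      exact ⟨C, MeasurableSet.of_discrete.prod hmC', rfl⟩
    · exact MeasurableSet.iInter fun k => (hmF _ _).compl
  refine hpos.trans_le (measure_mono_ae ?_)
  filter_upwards [hae, h.ae_isNearestNeighbour hd] with ω hω hnn hmem
  obtain ⟨hω0, hωF⟩ := hmem
  rw [Set.mem_iInter] at hωF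
  have hstep : ∀ D k, ω ∉ F D k → ∀ y ∈ T k, ∃ x ∈ B k \ D,
      Hits (fun x => Ξ x ω) (fun x n => S x n ω) x y := by
    intro D k hk y hy
    refine hits_of_notMem_missEvent (N := N k) fun hmiss => hk ?_
    exact Set.mem_biUnion hy hmiss
  refine visitTimes_infinite hnn (fun x => ?_) fun D => ?_
  · have hall : ∀ k, ∀ x ∈ B (k + K), activationTime (fun x => Ξ x ω) (fun x n => S x n ω) x ≠ ⊤ := by
      intro k
      induction k with
      | zero =>
        intro x hx
        rw [zero_add] at hx
        obtain ⟨hM0, hcov⟩ := hω0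
        obtain ⟨j, hj, hjx⟩ := hcov x hx
        refine activationTime_ne_top_of_hits (x := 0) ?_ ⟨j, lt_of_lt_of_le hj hM0, hjx⟩
        rw [activationTime_zero]
        exact ENat.zero_ne_top
      | succ k ih =>
        intro y hy
        rw [add_right_comm] at hy
        have h1 := hstep {0} (k + K) (hωF k)
        rcases hcover _ _ hnn (k + K) (fun y hy => by
          obtain ⟨x, hx, hxy⟩ := h1 y hy
          exact ⟨x, (Finset.mem_sdiff.1 hx).1, hxy⟩) y hy with hy | ⟨x, hx, hxy⟩
        · exact ih y hy
        · exact activationTime_ne_top_of_hits (ih x hx) hxy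
    obtain ⟨k₀, hk₀⟩ := hB x
    exact hall k₀ x (hk₀ _ (Nat.le_add_right _ _))
  · obtain ⟨k, hk⟩ := (hω D).exists
    obtain ⟨x, hx, hx0⟩ := hstep D k hk 0 (hT k)
    exact ⟨x, (Finset.mem_sdiff.1 hx).2, hx0⟩

end IsInput
end FrogModel

/-! ### Balls, scales and the criterion in terms of hit counts -/

namespace FrogModel

variable {d : ℕ}

open Classical in
/-- The sites of squared Euclidean norm at most `ρ`. -/
noncomputable def ball (d : ℕ) (ρ : ℝ) : Finset (Site d) :=
  (Finset.Icc (fun _ => -(⌈Real.sqrt ρ⌉₊ : ℤ)) (fun _ => (⌈Real.sqrt ρ⌉₊ : ℤ))).filter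
    fun x => normSq x ≤ ρ

lemma mem_ball {ρ : ℝ} {x : Site d} : x ∈ ball d ρ ↔ normSq x ≤ ρ := by
  rw [ball, Finset.mem_filter, and_iff_right_iff_imp]
  intro hx
  have h : ∀ i, |x i| ≤ (⌈Real.sqrt ρ⌉₊ : ℤ) := fun i => by
    have h1 : (x i : ℝ) ^ 2 ≤ ρ :=
      (Finset.single_le_sum (f := fun i => (x i : ℝ) ^ 2) (fun _ _ => sq_nonneg _)
        (Finset.mem_univ i)).trans hx
    have h2 : |(x i : ℝ)| ≤ ⌈Real.sqrt ρ⌉₊ := (Real.abs_le_sqrt h1).trans (Nat.le_ceil _)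
    exact_mod_cast h2
  rw [Finset.mem_Icc]
  exact ⟨fun i => (abs_le.1 (h i)).1, fun i => (abs_le.1 (h i)).2⟩

lemma card_ball_le (ρ : ℝ) : (ball d ρ).card ≤ (2 * ⌈Real.sqrt ρ⌉₊ + 1) ^ d := by
  refine (Finset.card_filter_le _ _).trans (le_of_eq ?_)
  rw [Pi.card_Icc]
  simp only [Int.card_Icc, Finset.prod_const, Finset.card_univ, Fintype.card_fin]
  congr 1
  omega

/-- The conclusion of `exists_occupation_lower_bound`. -/
def OccupationBound (d : ℕ) (c lam ρ₀ : ℝ) : Prop :=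
  ∀ ρ ≥ ρ₀, ∀ N : ℕ, ρ ≤ N → ∀ y : Site d, normSq y ≤ lam * ρ →
    c * ρ ≤ ∑ j ∈ Finset.range N,
      (avg d ^ j) (fun x : Site d => if normSq x ≤ ρ then (1 : ℝ) else 0) y

/-- The time scale of the ball of squared radius `lam ^ k`. -/
noncomputable def scale (lam : ℝ) (k : ℕ) : ℕ := ⌈Real.sqrt (lam ^ k)⌉₊

lemma sqrt_le_scale (lam : ℝ) (k : ℕ) : Real.sqrt (lam ^ k) ≤ scale lam k := Nat.le_ceil _

section scale

variable {lam : ℝ}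

lemma one_le_sqrt_pow (hlam : 1 < lam) (k : ℕ) : 1 ≤ Real.sqrt (lam ^ k) := by
  rw [Real.one_le_sqrt]
  exact one_le_pow₀ hlam.le

lemma one_le_scale (hlam : 1 < lam) (k : ℕ) : 1 ≤ scale lam k := by
  have := (one_le_sqrt_pow hlam k).trans (sqrt_le_scale lam k)
  exact_mod_cast this

lemma pow_le_scale_sq (lam : ℝ) (k : ℕ) : lam ^ k ≤ (scale lam k : ℝ) ^ 2 := by
  rw [← Real.sqrt_le_left (by positivity)]
  exact sqrt_le_scale lam k

lemma scale_le (hlam : 1 < lam) (k : ℕ) : (scale lam k : ℝ) ≤ 2 * Real.sqrt (lam ^ k) := by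
  have := Nat.ceil_lt_add_one (Real.sqrt_nonneg (lam ^ k))
  have := one_le_sqrt_pow hlam k
  unfold scale
  linarith

lemma scale_sq_le (hlam : 1 < lam) (k : ℕ) : (scale lam k : ℝ) ^ 2 / 4 ≤ lam ^ k := by
  have h0 : (0 : ℝ) ≤ lam ^ k := by positivity
  have h1 := Real.sq_sqrt h0
  have h2 := pow_le_pow_left₀ (by positivity) (scale_le hlam k) 2
  nlinarith

lemma tendsto_scale (hlam : 1 < lam) : Tendsto (scale lam) atTop atTop := by
  refine tendsto_nat_ceil_atTop.comp (Real.tendsto_sqrt_atTop.comp ?_)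
  exact tendsto_pow_atTop_atTop_of_one_lt hlam

end scale

/-- With `m = scale lam k`, the horizon `m ^ 2` is at least `lam ^ k`, so the occupation bound
applies, and at most `4 * lam ^ k`, so the bound can be stated in `m`; hence the division by 4. -/
lemma exponent_le {c lam ρ₀ q : ℝ} (hocc : OccupationBound d c lam ρ₀) (hlam : 1 < lam)
    (hc : 0 < c) (hq : 0 ≤ q) {k : ℕ} (hk : ρ₀ ≤ lam ^ k) {y : Site d}
    (hy : y ∈ ball d (lam ^ (k + 1))) :
    q * (c * (scale lam k : ℝ) ^ 2 / 4) / (green (scale lam k ^ 2) : Site d → ℝ) 0 ≤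
      q / (green (scale lam k ^ 2) : Site d → ℝ) 0 *
        ∑ x ∈ ball d (lam ^ k), green (scale lam k ^ 2) (y - x) := by
  have h1 := hocc _ hk (scale lam k ^ 2) (by exact_mod_cast pow_le_scale_sq lam k) y
    (by rw [← pow_succ']; exact mem_ball.1 hy)
  rw [sum_green]
  simp only [mem_ball]
  rw [mul_div_right_comm]
  refine mul_le_mul_of_nonneg_left (le_trans ?_ h1) (div_nonneg hq (green_nonneg _ _))
  have := mul_le_mul_of_nonneg_left (scale_sq_le hlam k) hc.le
  linarith

lemma exists_forall_mem_ball {lam : ℝ} (hlam : 1 < lam) (x : Site d) :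
    ∃ k₀, ∀ k ≥ k₀, x ∈ ball d (lam ^ k) := by
  obtain ⟨k₀, hk₀⟩ := eventually_atTop.1
    ((tendsto_pow_atTop_atTop_of_one_lt hlam).eventually_ge_atTop (normSq x))
  exact ⟨k₀, fun k hk => mem_ball.2 (hk₀ k hk)⟩

lemma zero_mem_ball {lam : ℝ} (hlam : 1 < lam) (k : ℕ) : (0 : Site d) ∈ ball d (lam ^ k) :=
  mem_ball.2 (by rw [normSq_zero]; positivity)

variable {Ω : Type*} [MeasurableSpace Ω] {P : Measure Ω} [IsProbabilityMeasure P] {ν : Measure ℕ}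
  [IsProbabilityMeasure ν] {Ξ : Site d → Ω → ℕ} {S : Site d → ℕ → Ω → Site d}

/-- In any dimension, it suffices that the expected number of hits of a site is of larger order than
the logarithm of the scale. -/
theorem IsInput.isRecurrent_of_log_le (h : IsInput P ν Ξ S) (hd : 1 ≤ d)
    (hν : ∀ N : ℕ, 0 < ν {k | N ≤ k}) {c lam ρ₀ : ℝ} (hocc : OccupationBound d c lam ρ₀)
    (hlam : 1 < lam) (hc : 0 < c)
    (hexp : ∀ᶠ m : ℕ in atTop, (d + 1) * Real.log m ≤
      ν.real {k | m ^ 2 ≤ k} * (c * (m : ℝ) ^ 2 / 4) / (green (m ^ 2) : Site d → ℝ) 0) :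
    IsRecurrent P Ξ S := by
  have hlam0 : 0 < lam := by linarith
  set C₁ : ℝ := 2 * Real.sqrt lam + 3 with hC₁
  -- About `m ^ d` sites, each missed with probability of order at most `m ^ (-(d + 1))`, leave `1 /
  -- m`, which decays geometrically in `k`.
  have hgeom : Summable fun k : ℕ => C₁ ^ d * (Real.sqrt lam)⁻¹ ^ k := by
    refine (summable_geometric_of_lt_one (by positivity) ?_).mul_left _
    refine inv_lt_one_of_one_lt₀ ?_
    rw [Real.lt_sqrt (by norm_num)]
    linarith
  refine h.isRecurrent_of_summable hd hν (B := fun k => ball d (lam ^ k))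
    (T := fun k => ball d (lam ^ (k + 1))) (N := fun k => scale lam k ^ 2)
    (fun k => Nat.one_le_pow _ _ (one_le_scale hlam k)) (exists_forall_mem_ball hlam)
    (fun k => zero_mem_ball hlam _) (fun L w _ k hk y hy => Or.inr (hk y hy)) hgeom ?_
  filter_upwards [(tendsto_scale hlam).eventually hexp,
    (tendsto_pow_atTop_atTop_of_one_lt hlam).eventually_ge_atTop ρ₀] with k hk hkρ y hy
  have h1 := hk.trans (exponent_le hocc hlam hc measureReal_nonneg hkρ hy)
  set m := scale lam k with hm
  have hm1 : (1 : ℝ) ≤ m := by exact_mod_cast one_le_scale hlam k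
  have hm0 : (0 : ℝ) < m := by linarith
  have hcard : ((ball d (lam ^ (k + 1))).card : ℝ) ≤ (C₁ * m) ^ d := by
    have h2 : ((ball d (lam ^ (k + 1))).card : ℝ) ≤
        (2 * (⌈Real.sqrt (lam ^ (k + 1))⌉₊ : ℝ) + 1) ^ d := by
      exact_mod_cast card_ball_le _
    refine h2.trans (pow_le_pow_left₀ (by positivity) ?_ d)
    have h3 : (⌈Real.sqrt (lam ^ (k + 1))⌉₊ : ℝ) < Real.sqrt (lam ^ (k + 1)) + 1 :=
      Nat.ceil_lt_add_one (Real.sqrt_nonneg _)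
    have h4 : Real.sqrt (lam ^ (k + 1)) = Real.sqrt (lam ^ k) * Real.sqrt lam := by
      rw [pow_succ, Real.sqrt_mul (by positivity)]
    have h5 := mul_le_mul_of_nonneg_right (sqrt_le_scale lam k) (Real.sqrt_nonneg lam)
    rw [← hm] at h5
    rw [hC₁]
    nlinarith
  have hexp' : Real.exp (-((d + 1) * Real.log m)) = ((m : ℝ) ^ (d + 1))⁻¹ := by
    rw [Real.exp_neg, ← Nat.cast_succ, Real.exp_nat_mul, Real.exp_log hm0]
  calc _ ≤ (C₁ * m) ^ d * Real.exp (-((d + 1) * Real.log m)) :=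
        mul_le_mul hcard (Real.exp_le_exp.2 (neg_le_neg h1)) (Real.exp_pos _).le (by positivity)
    _ = C₁ ^ d * (m : ℝ)⁻¹ := by
        rw [hexp', mul_pow, pow_succ]
        field_simp
    _ ≤ C₁ ^ d * (Real.sqrt lam)⁻¹ ^ k := by
        refine mul_le_mul_of_nonneg_left ?_ (by positivity)
        rw [inv_pow, inv_le_inv₀ hm0 (by positivity)]
        have := sqrt_le_scale lam k
        rwa [Real.sqrt_eq_rpow, ← Real.rpow_natCast, ← Real.rpow_mul hlam0.le, mul_comm,
          Real.rpow_mul hlam0.le, Real.rpow_natCast, ← Real.sqrt_eq_rpow] at this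

/-- A path with steps of size at most one takes all intermediate values. -/
lemma exists_eq_of_natAbs_step_le_one {f : ℕ → ℤ} (hf : ∀ n, (f (n + 1) - f n).natAbs ≤ 1) {a : ℤ}
    (h0 : f 0 ≤ a) {N : ℕ} (hN : a ≤ f N) : ∃ n ≤ N, f n = a := by
  induction N with
  | zero => exact ⟨0, le_rfl, le_antisymm h0 hN⟩
  | succ N ih =>
    rcases le_or_gt a (f N) with h | h
    · obtain ⟨n, hn, hna⟩ := ih h
      exact ⟨n, by omega, hna⟩
    · have := hf N
      exact ⟨N + 1, le_rfl, by omega⟩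

lemma hits_of_hits_beyond {L : Site 1 → ℕ} {w : Site 1 → ℕ → Site 1} (hw : IsNearestNeighbour w)
    {x y z : Site 1} (h : Hits L w x z) (hxyz : x 0 ≤ y 0 ∧ y 0 ≤ z 0 ∨ z 0 ≤ y 0 ∧ y 0 ≤ x 0) :
    Hits L w x y := by
  obtain ⟨N, hN, hNz⟩ := h
  have hstep : ∀ n, (w x (n + 1) 0 - w x n 0).natAbs ≤ 1 := fun n => hw.natAbs_step_le x n 0
  suffices ∃ n ≤ N, w x n 0 = y 0 by
    obtain ⟨n, hn, hny⟩ := this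
    refine ⟨n, by omega, ?_⟩
    ext i
    rw [Subsingleton.elim i 0, hny]
  rcases hxyz with ⟨h1, h2⟩ | ⟨h1, h2⟩
  · exact exists_eq_of_natAbs_step_le_one hstep (by rwa [hw.start]) (by rwa [hNz])
  · obtain ⟨n, hn, hny⟩ := exists_eq_of_natAbs_step_le_one (f := fun n => -w x n 0) (a := -y 0)
      (fun n => by have := hstep n; omega) (N := N) (by simp only [hw.start]; omega)
      (by simp only [hNz]; omega)
    exact ⟨n, hn, by omega⟩

/-- In dimension one, where only the endpoints of an interval have to be hit, it suffices that the
expected number of hits is of larger order than the iterated logarithm of the scale. -/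
theorem IsInput.isRecurrent_of_log_log_le {Ξ : Site 1 → Ω → ℕ} {S : Site 1 → ℕ → Ω → Site 1}
    (h : IsInput P ν Ξ S) (hν : ∀ N : ℕ, 0 < ν {k | N ≤ k}) {c lam ρ₀ : ℝ}
    (hocc : OccupationBound 1 c lam ρ₀) (hlam : 1 < lam) (hc : 0 < c)
    (hexp : ∀ᶠ m : ℕ in atTop, 2 * Real.log (Real.log m) ≤
      ν.real {k | m ^ 2 ≤ k} * (c * (m : ℝ) ^ 2 / 4) / (green (m ^ 2) : Site 1 → ℝ) 0) :
    IsRecurrent P Ξ S := by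
  classical
  have hlam0 : 0 < lam := by linarith
  have hlog : 0 < Real.log lam := Real.log_pos hlam
  set e : ℕ → Site 1 := fun k _ => (⌊Real.sqrt (lam ^ (k + 1))⌋₊ : ℤ) with he
  have hnorm : ∀ x : Site 1, normSq x = (x 0 : ℝ) ^ 2 := fun x => by simp [normSq]
  have hemem : ∀ k, e k ∈ ball 1 (lam ^ (k + 1)) := by
    intro k
    rw [mem_ball, hnorm, he]
    have h1 : (⌊Real.sqrt (lam ^ (k + 1))⌋₊ : ℝ) ≤ Real.sqrt (lam ^ (k + 1)) :=
      Nat.floor_le (Real.sqrt_nonneg _)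
    have h2 := pow_le_pow_left₀ (by positivity) h1 2
    rw [Real.sq_sqrt (by positivity)] at h2
    exact_mod_cast h2
  have hnegmem : ∀ k, -e k ∈ ball 1 (lam ^ (k + 1)) := by
    intro k
    have := hemem k
    rw [mem_ball, hnorm] at this ⊢
    simpa using this
  -- Three sites, each with a bound `(log m) ^ (-2)`, where `log m ≥ k * log lam / 2`.
  have hsum : Summable fun k : ℕ => 12 / Real.log lam ^ 2 * (1 / (k : ℝ) ^ 2) :=
    (Real.summable_one_div_nat_pow.2 one_lt_two).mul_left _
  refine h.isRecurrent_of_summable le_rfl hν (B := fun k => ball 1 (lam ^ k))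
    -- The endpoints `e k` and `-e k` of the next interval serve to activate it; the origin is
    -- included for the returns.
    (T := fun k => {0, e k, -e k}) (N := fun k => scale lam k ^ 2)
    (fun k => Nat.one_le_pow _ _ (one_le_scale hlam k)) (exists_forall_mem_ball hlam)
    (fun k => by simp) (fun L w hw k hk y hy => ?_) hsum ?_
  · by_cases hyk : y ∈ ball 1 (lam ^ k)
    · exact Or.inl hyk
    refine Or.inr ?_
    have hxy : ∀ x ∈ ball 1 (lam ^ k), |x 0| < |y 0| := by
      intro x hx
      rw [mem_ball, hnorm] at hx hyk
      rw [not_le] at hyk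
      have := sq_lt_sq.1 (hx.trans_lt hyk)
      exact_mod_cast this
    have hye : |y 0| ≤ e k 0 := by
      rw [mem_ball, hnorm] at hy
      have h1 : |(y 0 : ℝ)| ≤ Real.sqrt (lam ^ (k + 1)) := Real.abs_le_sqrt hy
      have h2 : ((y 0).natAbs : ℝ) ≤ Real.sqrt (lam ^ (k + 1)) := by
        rwa [Nat.cast_natAbs, Int.cast_abs]
      have h3 := Nat.le_floor h2
      rw [Int.abs_eq_natAbs]
      exact Int.ofNat_le.2 h3
    rcases le_total 0 (y 0) with hy0 | hy0
    · obtain ⟨x, hx, hxe⟩ := hk (e k) (by simp)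
      have := hxy x hx
      rw [abs_of_nonneg hy0] at this hye
      exact ⟨x, hx, hits_of_hits_beyond hw hxe (Or.inl ⟨by linarith [le_abs_self (x 0)], hye⟩)⟩
    · obtain ⟨x, hx, hxe⟩ := hk (-e k) (by simp)
      have := hxy x hx
      rw [abs_of_nonpos hy0] at this hye
      exact ⟨x, hx, hits_of_hits_beyond hw hxe
        (Or.inr ⟨by rw [Pi.neg_apply]; linarith, by linarith [neg_abs_le (x 0)]⟩)⟩
  · filter_upwards [(tendsto_scale hlam).eventually hexp, eventually_ge_atTop 1,
      (tendsto_pow_atTop_atTop_of_one_lt hlam).eventually_ge_atTop ρ₀] with k hk hk1 hkρ y hy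
    have hy' : y ∈ ball 1 (lam ^ (k + 1)) := by
      simp only [Finset.mem_insert, Finset.mem_singleton] at hy
      rcases hy with rfl | rfl | rfl
      · exact zero_mem_ball hlam _
      · exact hemem k
      · exact hnegmem k
    have h1 := hk.trans (exponent_le hocc hlam hc measureReal_nonneg hkρ hy')
    have hcard : (({0, e k, -e k} : Finset (Site 1)).card : ℝ) ≤ 3 := by
      exact_mod_cast Finset.card_le_three
    have hk0 : (0 : ℝ) < k := by exact_mod_cast hk1
    have hlogm : k * Real.log lam / 2 ≤ Real.log (scale lam k) := by
      have h2 := Real.log_le_log (by linarith [one_le_sqrt_pow hlam k]) (sqrt_le_scale lam k)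
      rwa [Real.log_sqrt (by positivity), Real.log_pow] at h2
    have hlogm0 : 0 < k * Real.log lam / 2 := by positivity
    have hexp' : Real.exp (-(2 * Real.log (Real.log (scale lam k)))) =
        (Real.log (scale lam k) ^ 2)⁻¹ := by
      rw [Real.exp_neg, mul_comm, ← Nat.cast_two, Real.exp_mul, Real.rpow_natCast,
        Real.exp_log (by linarith)]
    calc _ ≤ 3 * Real.exp (-(2 * Real.log (Real.log (scale lam k)))) :=
          mul_le_mul hcard (Real.exp_le_exp.2 (neg_le_neg h1)) (Real.exp_pos _).le (by norm_num)
      _ ≤ 3 * ((k * Real.log lam / 2) ^ 2)⁻¹ := by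
          rw [hexp']
          gcongr
      _ = _ := by
          field_simp
          norm_num

/-- Lifetimes are unbounded, which lets the origin's particle live long enough to cover any finite
set. -/
lemma measure_ge_pos_of_eventually_le {ν : Measure ℕ} {f : ℕ → ℝ} (hf : ∀ᶠ n in atTop, 0 < f n)
    (h : ∀ᶠ n : ℕ in atTop, f n ≤ ν.real {k | n ^ 2 ≤ k}) (N : ℕ) : 0 < ν {k | N ≤ k} := by
  obtain ⟨n, ⟨h1, h2⟩, h3⟩ := ((hf.and h).and (eventually_ge_atTop (N + 1))).exists
  have hsub : {k : ℕ | n ^ 2 ≤ k} ⊆ {k | N ≤ k} := fun k hk => by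
    have : n ^ 2 ≤ k := hk
    change N ≤ k
    nlinarith
  refine lt_of_lt_of_le ?_ (measure_mono hsub)
  rw [pos_iff_ne_zero]
  intro h0
  rw [Measure.real, h0, ENNReal.toReal_zero] at h2
  linarith

lemma eventually_log_pos : ∀ᶠ n : ℕ in atTop, 0 < Real.log n :=
  (Real.tendsto_log_atTop.comp tendsto_natCast_atTop_atTop).eventually_gt_atTop 0

lemma eventually_log_log_pos : ∀ᶠ n : ℕ in atTop, 0 < Real.log (Real.log n) :=
  (Real.tendsto_log_atTop.comp
    (Real.tendsto_log_atTop.comp tendsto_natCast_atTop_atTop)).eventually_gt_atTop 0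

end FrogModel

/-! ### The constants in each dimension -/

open FrogModel in
theorem exists_recurrence_constant_one : ∃ β : ℝ, 0 < β ∧
    ∀ (ν : Measure ℕ) [IsProbabilityMeasure ν],
      (∀ᶠ n : ℕ in atTop, β * (n : ℝ)⁻¹ * Real.log (Real.log n) ≤ ν.real {k | n ^ 2 ≤ k}) →
      ∀ (Ω : Type*) [MeasurableSpace Ω] (P : Measure Ω) [IsProbabilityMeasure P]
        (Ξ : Site 1 → Ω → ℕ) (S : Site 1 → ℕ → Ω → Site 1), IsInput P ν Ξ S → IsRecurrent P Ξ S := by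
  obtain ⟨c, lam, ρ₀, hc, hlam, hocc⟩ := exists_occupation_lower_bound (d := 1) le_rfl
  -- Chosen so that `β * c / 4 = 2`, the coefficient of the iterated logarithm, given `green (m ^ 2)
  -- 0 ≤ m`.
  refine ⟨8 / c, by positivity, fun ν _ hν Ω _ P _ Ξ S h => ?_⟩
  refine h.isRecurrent_of_log_log_le (measure_ge_pos_of_eventually_le ?_ hν) hocc hlam hc ?_
  · filter_upwards [eventually_log_log_pos, eventually_ge_atTop 1] with n hn hn1
    have : (0 : ℝ) < n := by exact_mod_cast hn1
    positivity
  · filter_upwards [hν, eventually_ge_atTop 1, eventually_log_log_pos] with m hm hm1 hlog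
    have hm0 : (0 : ℝ) < m := by exact_mod_cast hm1
    have hG := green_zero_le_one_dim (m ^ 2)
    push_cast at hG
    rw [Real.sqrt_sq hm0.le] at hG
    have hG0 : 0 < (green (m ^ 2) : Site 1 → ℝ) 0 :=
      zero_lt_one.trans_le (one_le_green_zero (Nat.one_le_pow _ _ hm1))
    rw [le_div_iff₀ hG0]
    calc 2 * Real.log (Real.log m) * (green (m ^ 2) : Site 1 → ℝ) 0
        ≤ 2 * Real.log (Real.log m) * m := mul_le_mul_of_nonneg_left hG (by positivity)
      _ = 8 / c * (m : ℝ)⁻¹ * Real.log (Real.log m) * (c * (m : ℝ) ^ 2 / 4) := by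
          field_simp
          norm_num
      _ ≤ _ := mul_le_mul_of_nonneg_right hm (by positivity)

open FrogModel in
theorem exists_recurrence_constant_two : ∃ β : ℝ, 0 < β ∧
    ∀ (ν : Measure ℕ) [IsProbabilityMeasure ν],
      (∀ᶠ n : ℕ in atTop, β * ((n : ℝ) ^ 2)⁻¹ * Real.log n ^ 2 ≤ ν.real {k | n ^ 2 ≤ k}) →
      ∀ (Ω : Type*) [MeasurableSpace Ω] (P : Measure Ω) [IsProbabilityMeasure P]
        (Ξ : Site 2 → Ω → ℕ) (S : Site 2 → ℕ → Ω → Site 2), IsInput P ν Ξ S → IsRecurrent P Ξ S := by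
  obtain ⟨c, lam, ρ₀, hc, hlam, hocc⟩ := exists_occupation_lower_bound (d := 2) one_le_two
  have hlog2 : 0 < Real.log 2 := Real.log_pos one_lt_two
  -- This is `4 * 3 * 3`: one 3 is `d + 1`, the other comes from `log (1 + m ^ 2) ≤ 3 * log m`. The
  -- second logarithm in the hypothesis pays for the growth of the Green function.
  refine ⟨36 / (c * Real.log 2), by positivity, fun ν _ hν Ω _ P _ Ξ S h => ?_⟩
  refine h.isRecurrent_of_log_le one_le_two (measure_ge_pos_of_eventually_le ?_ hν) hocc hlam hc ?_
  · filter_upwards [eventually_log_pos, eventually_ge_atTop 1] with n hn hn1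
    have : (0 : ℝ) < n := by exact_mod_cast hn1
    positivity
  · filter_upwards [hν, eventually_ge_atTop 2, eventually_log_pos] with m hm hm2 hlog
    have hm2' : (2 : ℝ) ≤ m := by exact_mod_cast hm2
    have hm0 : (0 : ℝ) < m := by linarith
    have hG := green_zero_le_two_dim (m ^ 2)
    have hlogm : Real.log (1 + ((m ^ 2 : ℕ) : ℝ)) ≤ 3 * Real.log m := by
      rw [show (3 : ℝ) * Real.log m = Real.log ((m : ℝ) ^ 3) by rw [Real.log_pow]; norm_num]
      refine Real.log_le_log (by positivity) ?_
      push_cast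
      nlinarith
    have hG0 : 0 < (green (m ^ 2) : Site 2 → ℝ) 0 :=
      zero_lt_one.trans_le (one_le_green_zero (Nat.one_le_pow _ _ (by omega)))
    have hG' : (green (m ^ 2) : Site 2 → ℝ) 0 ≤ 3 * Real.log m / Real.log 2 := by
      rw [le_div_iff₀ hlog2, mul_comm]
      exact hG.trans hlogm
    rw [le_div_iff₀ hG0]
    push_cast
    calc (2 + 1) * Real.log m * (green (m ^ 2) : Site 2 → ℝ) 0
        ≤ (2 + 1) * Real.log m * (3 * Real.log m / Real.log 2) :=
          mul_le_mul_of_nonneg_left hG' (by positivity)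
      _ = 36 / (c * Real.log 2) * ((m : ℝ) ^ 2)⁻¹ * Real.log m ^ 2 * (c * (m : ℝ) ^ 2 / 4) := by
          field_simp
          norm_num
      _ ≤ _ := mul_le_mul_of_nonneg_right hm (by positivity)

open FrogModel in
theorem exists_recurrence_constant_of_three_le {d : ℕ} (hd : 3 ≤ d) : ∃ β : ℝ, 0 < β ∧
    ∀ (ν : Measure ℕ) [IsProbabilityMeasure ν],
      (∀ᶠ n : ℕ in atTop, β * ((n : ℝ) ^ 2)⁻¹ * Real.log n ≤ ν.real {k | n ^ 2 ≤ k}) →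
      ∀ (Ω : Type*) [MeasurableSpace Ω] (P : Measure Ω) [IsProbabilityMeasure P]
        (Ξ : Site d → Ω → ℕ) (S : Site d → ℕ → Ω → Site d), IsInput P ν Ξ S → IsRecurrent P Ξ S := by
  have hd1 : 1 ≤ d := by omega
  obtain ⟨c, lam, ρ₀, hc, hlam, hocc⟩ := exists_occupation_lower_bound hd1
  obtain ⟨C, hC, hG⟩ := exists_green_zero_le hd
  refine ⟨4 * (d + 1) * C / c, by positivity, fun ν _ hν Ω _ P _ Ξ S h => ?_⟩
  refine h.isRecurrent_of_log_le hd1 (measure_ge_pos_of_eventually_le ?_ hν) hocc hlam hc ?_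
  · filter_upwards [eventually_log_pos, eventually_ge_atTop 1] with n hn hn1
    have : (0 : ℝ) < n := by exact_mod_cast hn1
    positivity
  · filter_upwards [hν, eventually_ge_atTop 1, eventually_log_pos] with m hm hm1 hlog
    have hm0 : (0 : ℝ) < m := by exact_mod_cast hm1
    have hG0 : 0 < (green (m ^ 2) : Site d → ℝ) 0 :=
      zero_lt_one.trans_le (one_le_green_zero (Nat.one_le_pow _ _ hm1))
    rw [le_div_iff₀ hG0]
    calc (d + 1) * Real.log m * (green (m ^ 2) : Site d → ℝ) 0
        ≤ (d + 1) * Real.log m * C := mul_le_mul_of_nonneg_left (hG _) (by positivity)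
      _ = 4 * (d + 1) * C / c * ((m : ℝ) ^ 2)⁻¹ * Real.log m * (c * (m : ℝ) ^ 2 / 4) := by
          field_simp
      _ ≤ _ := mul_le_mul_of_nonneg_right hm (by positivity)

theorem theorem2p14 :
    ∃ β : ℕ → ℝ, (∀ d, 1 ≤ d → 0 < β d) ∧
      ∀ (d : ℕ) (ν : Measure ℕ) [IsProbabilityMeasure ν],
        ((d = 1 ∧ ∀ᶠ n : ℕ in atTop,
            β 1 * (n : ℝ)⁻¹ * Real.log (Real.log n) ≤ ν.real {k | n ^ 2 ≤ k}) ∨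
          (d = 2 ∧ ∀ᶠ n : ℕ in atTop,
            β 2 * ((n : ℝ) ^ 2)⁻¹ * Real.log n ^ 2 ≤ ν.real {k | n ^ 2 ≤ k}) ∨
          (3 ≤ d ∧ ∀ᶠ n : ℕ in atTop,
            β d * ((n : ℝ) ^ 2)⁻¹ * Real.log n ≤ ν.real {k | n ^ 2 ≤ k})) →
        ∀ (Ω : Type*) [MeasurableSpace Ω] (P : Measure Ω) [IsProbabilityMeasure P]
          (Ξ : FrogModel.Site d → Ω → ℕ)
          (S : FrogModel.Site d → ℕ → Ω → FrogModel.Site d),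
          FrogModel.IsInput P ν Ξ S → FrogModel.IsRecurrent P Ξ S := by
  obtain ⟨β₁, hβ₁, h₁⟩ := exists_recurrence_constant_one
  obtain ⟨β₂, hβ₂, h₂⟩ := exists_recurrence_constant_two
  choose β hβ h₃ using fun d : ℕ => exists_recurrence_constant_of_three_le (Nat.le_add_left 3 d)
  -- The family `β` is indexed by `d - 3`; the truncated value at `d = 0` is irrelevant, as no
  -- alternative allows `d = 0`.
  refine ⟨fun d => if d = 1 then β₁ else if d = 2 then β₂ else β (d - 3), fun d _ => ?_, ?_⟩
  · dsimp only
    split_ifs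
    exacts [hβ₁, hβ₂, hβ _]
  · rintro d ν _ (⟨rfl, hν⟩ | ⟨rfl, hν⟩ | ⟨hd, hν⟩)
    · exact h₁ ν (by simpa using hν)
    · exact h₂ ν (by simpa using hν)
    · obtain ⟨d, rfl⟩ := Nat.exists_eq_add_of_le' hd
      refine h₃ d ν ?_
      simpa [show d + 3 ≠ 1 by omega, show d + 3 ≠ 2 by omega] using hν
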